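/- Let $G$ be a finite group. A rational $G$-Mackey functor $M$ consists of $\mathbb{Q}$-modules $M(G/H)$ for $H\le G$, with restriction maps $R^H_K$, induction maps $I^H_K$ (for $K\le H$) and conjugation maps $C_g\colon M(G/H)\to M(G/gHg^{-1})$ (for $g\in G$), which are linear and satisfy the usual axioms: identities ($R^H_H=I^H_H=\mathrm{id}$, and $C_h=\mathrm{id}$ on $M(G/H)$ for $h\in H$), transitivity, equivariance, and the Mackey double coset formula. Let $\mathrm{Mack}_{\mathbb Q}(G)$ be the category of these. The rational Burnside ring $A_{\mathbb Q}(K)$ acts on $M(G/K)$ by linear extension of $[K/L]\mapsto I^K_L\circ R^K_L$. For $H\le G$ let $W_GH=N_GH/H$, and let $e_H^G\in A_{\mathbb Q}(G)$ be the idempotent that corresponds to the characteristic function of the conjugacy class $(H)$ under the isomorphism $A_{\mathbb Q}(G)\cong C(\mathrm{Sub}(G)/G,\mathbb Q)$, $T\mapsto\big((K)\mapsto |T^K|\big)$. Let $e_H^G\mathrm{Mack}_{\mathbb Q}(G)$ be the full subcategory of those $M$ with $M=e_H^GM$, i.e. $R^G_K(e_H^G)\,M(G/K)=M(G/K)$ for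 all $K\le G$. Let $U_H$ be the functor from it to $\mathbb{Q}[W_GH]$-modules given by $U_H(M)=M(G/H)$, where $W_GH$ acts through the conjugation maps. For a $\mathbb{Q}[W_GH]$-module $V$ let $F_H(V)$ be the Mackey functor $$F_H(V)(G/K)=\Big(\bigoplus_{\sigma\in (G/K)^H}V\Big)^{W_GH}\cong\big(\mathbb{Q}[(G/K)^H]\otimes V\big)^{W_GH},$$ that is, the families $(y_\sigma)_{\sigma\in(G/K)^H}$ in $V$ with $y_{n\sigma}=n\,y_\sigma$ for $n\in N_GH$. For $L\le K$ with projection $\alpha\colon G/L\to G/K$, its structure maps are $(R^K_Ly)_\sigma=y_{\alpha\sigma}$ and $(I^K_Ly)_\tau=\sum_{\alpha\sigma=\tau}y_\sigma$; moreover $(C_gy)_{x\,gKg^{-1}}=y_{xgK}$. **Theorem.** (1) For each $H\le G$, the functor $F_H$ takes values in $e_H^G\mathrm{Mack}_{\mathbb Q}(G)$, and $U_H$ and $F_H$ are mutually inverse equivalences of categories $$U_H\colon e_H^G\,\mathrm{Mack}_{\mathbb Q}(G)\ \rightleftarrows\ \mathbb{Q}[W_GH]\text{-mod}\ :F_H .$$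 (2) There is an equivalence of categories $$\mathrm{Mack}_{\mathbb Q}(G)\ \simeq\ \prod_{(H)\le G}\mathbb{Q}[W_GH]\text{-mod},$$ where the product runs over the conjugacy classes of subgroups of $G$, with one representative $H$ chosen (arbitrarily) in each class. -/

import Mathlib

open CategoryTheory
open scoped Pointwise MonoidAlgebra

universe u v w

namespace RatMackey

/-! ### Rational Mackey functors -/

/-- `s` is a complete system of representatives in `H` of the double cosets `K \ H / L`. -/
def IsDoubleCosetReps {G : Type u} [Group G] (K H L : Subgroup G) (s : Finset G) : Prop :=
  (∀ x ∈ s, x ∈ H) ∧ ∀ h ∈ H, ∃! x, x ∈ s ∧ ∃ k ∈ K, ∃ l ∈ L, h = k * x * l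

theorem conj_inf {G : Type u} [Group G] (x : G) (K L : Subgroup G) :
    K ⊓ MulAut.conj x • L = MulAut.conj x • (L ⊓ MulAut.conj x⁻¹ • K) := by
  rw [Subgroup.smul_inf, smul_smul, ← map_mul, mul_inv_cancel, map_one, one_smul, inf_comm]

/-- A rational `G`-Mackey functor. Here `obj H` is the value at `G/H`, and
`conj g e : obj H → obj H'` is the conjugation map `C_g`, where `e : H' = g H g⁻¹`. -/
structure MackeyFunctor (G : Type u) [Group G] where
  obj : Subgroup G → Type v
  [addCommGroup : ∀ H, AddCommGroup (obj H)]
  [module : ∀ H, Module ℚ (obj H)]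
  res : ∀ {K H : Subgroup G}, K ≤ H → (obj H →ₗ[ℚ] obj K)
  ind : ∀ {K H : Subgroup G}, K ≤ H → (obj K →ₗ[ℚ] obj H)
  conj : ∀ (g : G) {H H' : Subgroup G}, H' = MulAut.conj g • H → (obj H →ₗ[ℚ] obj H')
  res_self : ∀ (H : Subgroup G) (m : obj H), res (le_refl H) m = m
  ind_self : ∀ (H : Subgroup G) (m : obj H), ind (le_refl H) m = m
  conj_self : ∀ {H : Subgroup G} (h : G) (_ : h ∈ H) (e : H = MulAut.conj h • H) (m : obj H),
    conj h e m = m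
  res_trans : ∀ {L K H : Subgroup G} (hLK : L ≤ K) (hKH : K ≤ H) (m : obj H),
    res (hLK.trans hKH) m = res hLK (res hKH m)
  ind_trans : ∀ {L K H : Subgroup G} (hLK : L ≤ K) (hKH : K ≤ H) (m : obj L),
    ind (hLK.trans hKH) m = ind hKH (ind hLK m)
  conj_mul : ∀ (g h : G) {H H' H'' : Subgroup G} (e : H' = MulAut.conj h • H)
    (e' : H'' = MulAut.conj g • H') (e'' : H'' = MulAut.conj (g * h) • H) (m : obj H),
    conj (g * h) e'' m = conj g e' (conj h e m)
  res_conj : ∀ (g : G) {K H K' H' : Subgroup G} (hKH : K ≤ H) (hKH' : K' ≤ H')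
    (eK : K' = MulAut.conj g • K) (eH : H' = MulAut.conj g • H) (m : obj H),
    res hKH' (conj g eH m) = conj g eK (res hKH m)
  ind_conj : ∀ (g : G) {K H K' H' : Subgroup G} (hKH : K ≤ H) (hKH' : K' ≤ H')
    (eK : K' = MulAut.conj g • K) (eH : H' = MulAut.conj g • H) (m : obj K),
    ind hKH' (conj g eK m) = conj g eH (ind hKH m)
  mackey : ∀ {K L H : Subgroup G} (hK : K ≤ H) (hL : L ≤ H) (s : Finset G),
    IsDoubleCosetReps K H L s → ∀ m : obj L,
      res hK (ind hL m) = ∑ x ∈ s,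
        ind (K := K ⊓ MulAut.conj x • L) (H := K) inf_le_left
          (conj x (conj_inf x K L)
            (res (K := L ⊓ MulAut.conj x⁻¹ • K) (H := L) inf_le_left m))

attribute [instance] MackeyFunctor.addCommGroup MackeyFunctor.module

namespace MackeyFunctor

variable {G : Type u} [Group G]

/-- Morphisms of Mackey functors: families of linear maps that commute with restriction,
induction and conjugation. -/
@[ext]
structure Hom (M N : MackeyFunctor.{u, v} G) where
  app : ∀ H : Subgroup G, M.obj H →ₗ[ℚ] N.obj H
  app_res : ∀ {K H : Subgroup G} (h : K ≤ H) (m : M.obj H),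
    app K (M.res h m) = N.res h (app H m)
  app_ind : ∀ {K H : Subgroup G} (h : K ≤ H) (m : M.obj K),
    app H (M.ind h m) = N.ind h (app K m)
  app_conj : ∀ (g : G) {H H' : Subgroup G} (e : H' = MulAut.conj g • H) (m : M.obj H),
    app H' (M.conj g e m) = N.conj g e (app H m)

instance : Category (MackeyFunctor.{u, v} G) where
  Hom M N := Hom M N
  id M :=
    { app := fun _ => LinearMap.id
      app_res := fun _ _ => rfl
      app_ind := fun _ _ => rfl
      app_conj := fun _ _ _ _ _ => rfl }
  comp f g :=
    { app := fun H => g.app H ∘ₗ f.app H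
      app_res := fun h m => by simp [f.app_res, g.app_res]
      app_ind := fun h m => by simp [f.app_ind, g.app_ind]
      app_conj := fun x _ _ e m => by simp [f.app_conj, g.app_conj] }

end MackeyFunctor

/-! ### The rational Burnside ring -/

/-- A finite `G`-set. -/
structure FinGSet (G : Type u) [Group G] where
  carrier : Type u
  [action : MulAction G carrier]
  [finite : Finite carrier]

attribute [instance] FinGSet.action FinGSet.finite

namespace FinGSet

variable {G : Type u} [Group G]

/-- Two finite `G`-sets are isomorphic if there is an equivariant bijection between them. -/
def Iso (X Y : FinGSet G) : Prop :=
  ∃ f : X.carrier ≃ Y.carrier, ∀ (g : G) (x : X.carrier), f (g • x) = g • f x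

instance isoSetoid (G : Type u) [Group G] : Setoid (FinGSet G) where
  r := Iso
  iseqv :=
    { refl := fun X => ⟨Equiv.refl _, fun _ _ => rfl⟩
      symm := by
        rintro X Y ⟨f, hf⟩
        exact ⟨f.symm, fun g y => by rw [Equiv.symm_apply_eq, hf, Equiv.apply_symm_apply]⟩
      trans := by
        rintro X Y Z ⟨f, hf⟩ ⟨f', hf'⟩
        exact ⟨f.trans f', fun g x => by simp [hf, hf']⟩ }

/-- Product of `G`-sets, with the diagonal action. -/
def prod (X Y : FinGSet G) : FinGSet G := ⟨X.carrier × Y.carrier⟩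

/-- The one-point `G`-set. -/
def point (G : Type u) [Group G] : FinGSet G where
  carrier := PUnit
  action := { smul := fun _ x => x, one_smul := fun _ => rfl, mul_smul := fun _ _ _ => rfl }

/-- Disjoint union of `G`-sets. -/
def sum (X Y : FinGSet G) : FinGSet G where
  carrier := X.carrier ⊕ Y.carrier
  action :=
    { smul := fun g => Sum.map (g • ·) (g • ·)
      one_smul := by
        rintro (x | y)
        · exact congrArg Sum.inl (one_smul G x)
        · exact congrArg Sum.inr (one_smul G y)
      mul_smul := by
        rintro g h (x | y)
        · exact congrArg Sum.inl (mul_smul g h x)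
        · exact congrArg Sum.inr (mul_smul g h y) }

/-- The transitive `G`-set `G/H`. -/
def orbit [Finite G] (H : Subgroup G) : FinGSet G := ⟨G ⧸ H⟩

/-- A `G`-set viewed as a `K`-set. -/
def restrict (K : Subgroup G) (X : FinGSet G) : FinGSet K := ⟨X.carrier⟩

@[simp] theorem smul_sum_inl (X Y : FinGSet G) (g : G) (x : X.carrier) :
    (g • (Sum.inl x : (sum X Y).carrier) : (sum X Y).carrier) = Sum.inl (g • x) := rfl

@[simp] theorem smul_sum_inr (X Y : FinGSet G) (g : G) (y : Y.carrier) :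
    (g • (Sum.inr y : (sum X Y).carrier) : (sum X Y).carrier) = Sum.inr (g • y) := rfl

end FinGSet

/-- Isomorphism classes of finite `G`-sets. -/
def IsoClass (G : Type u) [Group G] : Type (u + 1) := Quotient (FinGSet.isoSetoid G)

namespace IsoClass

variable {G : Type u} [Group G]

/-- The isomorphism class of a finite `G`-set. -/
def mk (X : FinGSet G) : IsoClass G := Quotient.mk _ X

theorem mk_eq_mk {X Y : FinGSet G} : mk X = mk Y ↔ FinGSet.Iso X Y := Quotient.eq

/-- The product of isomorphism classes is induced by the product of `G`-sets. -/
instance : CommMonoid (IsoClass G) where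
  mul := Quotient.map₂ FinGSet.prod (by
    rintro X X' ⟨f, hf⟩ Y Y' ⟨f', hf'⟩
    exact ⟨Equiv.prodCongr f f', fun g x => Prod.ext (hf g x.1) (hf' g x.2)⟩)
  one := mk (FinGSet.point G)
  mul_assoc := by
    rintro ⟨X⟩ ⟨Y⟩ ⟨Z⟩
    exact Quotient.sound ⟨Equiv.prodAssoc _ _ _, fun _ _ => rfl⟩
  one_mul := by
    rintro ⟨X⟩
    exact Quotient.sound ⟨Equiv.punitProd _, fun _ _ => rfl⟩
  mul_one := by
    rintro ⟨X⟩
    exact Quotient.sound ⟨Equiv.prodPUnit _, fun _ _ => rfl⟩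
  mul_comm := by
    rintro ⟨X⟩ ⟨Y⟩
    exact Quotient.sound ⟨Equiv.prodComm _ _, fun _ _ => rfl⟩

theorem mk_mul (X Y : FinGSet G) : mk X * mk Y = mk (FinGSet.prod X Y) := rfl

theorem one_def : (1 : IsoClass G) = mk (FinGSet.point G) := rfl

end IsoClass

/-- The additivity relations `[X ⊔ Y] - [X] - [Y]`. -/
def burnsideRel (G : Type u) [Group G] : Set ℚ[IsoClass G] :=
  {z | ∃ X Y : FinGSet G, z = MonoidAlgebra.single (IsoClass.mk (FinGSet.sum X Y)) 1
    - MonoidAlgebra.single (IsoClass.mk X) 1 - MonoidAlgebra.single (IsoClass.mk Y) 1}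

/-- The rational Burnside ring `A_ℚ(G)`: the rational Grothendieck ring of finite `G`-sets under
disjoint union and product. -/
abbrev BurnsideRing (G : Type u) [Group G] : Type (u + 1) :=
  ℚ[IsoClass G] ⧸ Ideal.span (burnsideRel G)

namespace BurnsideRing

variable {G : Type u} [Group G]

/-- The class in the Burnside ring of a finite `G`-set. -/
noncomputable def mk (X : FinGSet G) : BurnsideRing G :=
  Ideal.Quotient.mk _ (MonoidAlgebra.single (IsoClass.mk X) 1)

theorem mk_sum (X Y : FinGSet G) : mk (FinGSet.sum X Y) = mk X + mk Y := by
  rw [mk, mk, mk, ← map_add, Ideal.Quotient.mk_eq_mk_iff_sub_mem, ← sub_sub]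
  exact Ideal.subset_span ⟨X, Y, rfl⟩

theorem mk_iso {X Y : FinGSet G} (h : FinGSet.Iso X Y) : mk X = mk Y := by
  rw [mk, mk, IsoClass.mk_eq_mk.2 h]

/-- A multiplicative and additive isomorphism invariant of finite `G`-sets extends to an algebra
map on the Burnside ring. -/
noncomputable def liftAlgHom {A : Type w} [CommRing A] [Algebra ℚ A] (f : IsoClass G →* A)
    (hf : ∀ X Y : FinGSet G, f (IsoClass.mk (FinGSet.sum X Y)) =
      f (IsoClass.mk X) + f (IsoClass.mk Y)) : BurnsideRing G →ₐ[ℚ] A :=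
  Ideal.Quotient.liftₐ _ (MonoidAlgebra.lift ℚ A (IsoClass G) f) (by
    intro a ha
    have h : Ideal.span (burnsideRel G) ≤
        RingHom.ker (MonoidAlgebra.lift ℚ A (IsoClass G) f) := by
      rw [Ideal.span_le]
      rintro _ ⟨X, Y, rfl⟩
      simp [RingHom.mem_ker, hf]
    exact h ha)

theorem liftAlgHom_mk {A : Type w} [CommRing A] [Algebra ℚ A] (f : IsoClass G →* A)
    (hf : ∀ X Y : FinGSet G, f (IsoClass.mk (FinGSet.sum X Y)) =
      f (IsoClass.mk X) + f (IsoClass.mk Y)) (X : FinGSet G) :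
    liftAlgHom f hf (mk X) = f (IsoClass.mk X) := by
  change (MonoidAlgebra.lift ℚ A (IsoClass G) f) (MonoidAlgebra.single (IsoClass.mk X) 1) = _
  simp

/-- The restriction map `R_K : A_ℚ(G) → A_ℚ(K)`, given by restricting actions. -/
noncomputable def res (K : Subgroup G) : BurnsideRing G →ₐ[ℚ] BurnsideRing K :=
  liftAlgHom
    { toFun := Quotient.lift (fun X => mk (FinGSet.restrict K X)) (by
        rintro X Y ⟨f, hf⟩
        exact mk_iso ⟨f, fun g x => hf g x⟩)
      map_one' := by
        change mk (FinGSet.restrict K (FinGSet.point G)) = 1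
        exact mk_iso (Y := FinGSet.point K) ⟨Equiv.refl _, fun _ _ => rfl⟩
      map_mul' := by
        rintro ⟨X⟩ ⟨Y⟩
        change mk (FinGSet.restrict K (FinGSet.prod X Y)) =
          mk (FinGSet.restrict K X) * mk (FinGSet.restrict K Y)
        rw [mk, mk, mk, ← map_mul, MonoidAlgebra.single_mul_single, mul_one]
        rfl }
    (by
      intro X Y
      change mk (FinGSet.restrict K (FinGSet.sum X Y)) =
        mk (FinGSet.restrict K X) + mk (FinGSet.restrict K Y)
      rw [← mk_sum]
      refine mk_iso ⟨Equiv.refl _, ?_⟩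
      rintro g (x | y) <;> rfl)

theorem res_mk (K : Subgroup G) (X : FinGSet G) : res K (mk X) = mk (FinGSet.restrict K X) :=
  liftAlgHom_mk _ _ X

end BurnsideRing

/-! ### Marks, tom Dieck's isomorphism and the idempotents -/

/-- Conjugacy of subgroups. -/
instance conjSetoid (G : Type u) [Group G] : Setoid (Subgroup G) where
  r H K := ∃ g : G, K = MulAut.conj g • H
  iseqv :=
    { refl := fun H => ⟨1, by simp⟩
      symm := by
        rintro H K ⟨g, rfl⟩
        exact ⟨g⁻¹, by rw [smul_smul, ← map_mul, inv_mul_cancel, map_one, one_smul]⟩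
      trans := by
        rintro H K L ⟨g, rfl⟩ ⟨g', rfl⟩
        exact ⟨g' * g, by rw [smul_smul, ← map_mul]⟩ }

/-- The set `Sub(G)/G` of conjugacy classes of subgroups of `G`. -/
abbrev ConjSub (G : Type u) [Group G] : Type u := Quotient (conjSetoid G)

/-- The conjugacy class `(H)`. -/
abbrev ConjSub.mk {G : Type u} [Group G] (H : Subgroup G) : ConjSub G := Quotient.mk _ H

theorem mem_conj_iff {G : Type u} [Group G] {g x : G} {H : Subgroup G} :
    x ∈ MulAut.conj g • H ↔ g⁻¹ * x * g ∈ H := by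
  rw [Subgroup.mem_pointwise_smul_iff_inv_smul_mem, ← map_inv, MulAut.smul_def,
    MulAut.conj_apply, inv_inv]

namespace FinGSet

variable {G : Type u} [Group G]

/-- The number of `H`-fixed points of a finite `G`-set. -/
noncomputable def fixedCard (H : Subgroup G) (X : FinGSet G) : ℕ :=
  Nat.card {x : X.carrier // ∀ h ∈ H, h • x = x}

theorem fixedCard_iso (H : Subgroup G) {X Y : FinGSet G} (h : Iso X Y) :
    fixedCard H X = fixedCard H Y := by
  obtain ⟨f, hf⟩ := h
  refine Nat.card_congr (f.subtypeEquiv fun x => forall₂_congr fun h _ => ?_)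
  rw [← hf, f.apply_eq_iff_eq]

theorem fixedCard_conj (g : G) (H : Subgroup G) (X : FinGSet G) :
    fixedCard (MulAut.conj g • H) X = fixedCard H X := by
  refine Nat.card_congr ((MulAction.toPerm g⁻¹).subtypeEquiv fun x => ?_)
  simp only [MulAction.toPerm_apply]
  constructor
  · intro hx h hh
    have := hx (g * h * g⁻¹) (by rw [mem_conj_iff]; simpa [mul_assoc] using hh)
    rw [smul_smul, eq_inv_smul_iff, smul_smul, ← mul_assoc, this]
  · intro hx h hh
    have := hx _ (mem_conj_iff.1 hh)
    rwa [smul_smul, eq_inv_smul_iff, smul_smul, mul_assoc, mul_assoc, mul_inv_cancel_left,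
      mul_inv_cancel, mul_one] at this

theorem fixedCard_sum (H : Subgroup G) (X Y : FinGSet G) :
    fixedCard H (sum X Y) = fixedCard H X + fixedCard H Y := by
  rw [fixedCard, fixedCard, fixedCard, ← Nat.card_sum]
  refine Nat.card_congr ((Equiv.subtypeSum (α := X.carrier) (β := Y.carrier)).trans
    (Equiv.sumCongr (Equiv.subtypeEquivRight fun x => ?_) (Equiv.subtypeEquivRight fun x => ?_)))
  · exact forall₂_congr fun h _ => (by
      rw [← Sum.inl.injEq (α := X.carrier) (β := Y.carrier)]; rfl)
  · exact forall₂_congr fun h _ => (by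
      rw [← Sum.inr.injEq (α := X.carrier) (β := Y.carrier)]; rfl)

theorem fixedCard_prod (H : Subgroup G) (X Y : FinGSet G) :
    fixedCard H (prod X Y) = fixedCard H X * fixedCard H Y := by
  rw [fixedCard, fixedCard, fixedCard, ← Nat.card_prod]
  refine Nat.card_congr (Equiv.trans (Equiv.subtypeEquivRight fun x => ?_)
    (Equiv.subtypeProdEquivProd (p := fun x : X.carrier => ∀ h ∈ H, h • x = x)
      (q := fun y : Y.carrier => ∀ h ∈ H, h • y = y)))
  constructor
  · exact fun hx => ⟨fun h hh => congrArg Prod.fst (hx h hh),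
      fun h hh => congrArg Prod.snd (hx h hh)⟩
  · exact fun hx h hh => Prod.ext (hx.1 h hh) (hx.2 h hh)

theorem fixedCard_point (H : Subgroup G) : fixedCard H (point G) = 1 := by
  rw [fixedCard, Nat.card_eq_one_iff_unique]
  exact ⟨⟨fun _ _ => Subtype.ext rfl⟩, ⟨⟨PUnit.unit, fun _ _ => rfl⟩⟩⟩

theorem fixed_mk_iff (K H : Subgroup G) (g : G) :
    (∀ k ∈ K, k • (g : G ⧸ H) = g) ↔ K ≤ MulAut.conj g • H := by
  refine forall₂_congr fun k _ => ?_
  rw [mem_conj_iff, ← H.inv_mem_iff, MulAction.Quotient.smul_mk, QuotientGroup.eq]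
  simp [mul_assoc]

theorem exists_of_fixedCard_ne_zero [Finite G] {K H : Subgroup G}
    (h : fixedCard K (orbit H) ≠ 0) : ∃ g : G, K ≤ MulAut.conj g • H := by
  rw [fixedCard, ← Nat.pos_iff_ne_zero, Nat.card_pos_iff] at h
  obtain ⟨⟨x, hx⟩⟩ := h.1
  induction x using QuotientGroup.induction_on with
  | H g => exact ⟨g, (fixed_mk_iff K H g).1 hx⟩

theorem fixedCard_self_ne_zero [Finite G] (H : Subgroup G) : fixedCard H (orbit H) ≠ 0 := by
  rw [fixedCard, ← Nat.pos_iff_ne_zero, Nat.card_pos_iff]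
  refine ⟨⟨⟨((1 : G) : G ⧸ H), (fixed_mk_iff H H 1).2 (by simp)⟩⟩, inferInstance⟩

theorem orbit_iso_conj [Finite G] (g : G) (H : Subgroup G) :
    Iso (orbit H) (orbit (MulAut.conj g • H)) := by
  refine ⟨Quotient.congr (Equiv.mulRight g⁻¹) fun a b => ?_, ?_⟩
  · rw [QuotientGroup.leftRel_apply, QuotientGroup.leftRel_apply, mem_conj_iff]
    simp [mul_assoc]
  · intro x y
    induction y using QuotientGroup.induction_on with
    | H y => exact congrArg QuotientGroup.mk (mul_assoc x y g⁻¹)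

end FinGSet

namespace BurnsideRing

variable {G : Type u} [Group G]

/-- The mark homomorphism `A_ℚ(G) → C(Sub(G)/G, ℚ)`, sending a finite `G`-set `T` to the function
`(H) ↦ |T^H|`. -/
noncomputable def marks (G : Type u) [Group G] : BurnsideRing G →ₐ[ℚ] (ConjSub G → ℚ) :=
  liftAlgHom
    { toFun := Quotient.lift (fun X => Quotient.lift (fun H => (FinGSet.fixedCard H X : ℚ)) (by
          rintro H _ ⟨g, rfl⟩
          rw [FinGSet.fixedCard_conj])) (by
        rintro X Y h
        funext c
        induction c using Quotient.inductionOn with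
        | h H => exact congrArg Nat.cast (FinGSet.fixedCard_iso H h))
      map_one' := by
        funext c
        induction c using Quotient.inductionOn with
        | h H => exact (congrArg Nat.cast (FinGSet.fixedCard_point H)).trans Nat.cast_one
      map_mul' := by
        rintro ⟨X⟩ ⟨Y⟩
        funext c
        induction c using Quotient.inductionOn with
        | h H =>
          exact (congrArg Nat.cast (FinGSet.fixedCard_prod H X Y)).trans (Nat.cast_mul _ _) }
    (by
      intro X Y
      funext c
      induction c using Quotient.inductionOn with
      | h H => exact (congrArg Nat.cast (FinGSet.fixedCard_sum H X Y)).trans (Nat.cast_add _ _))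

theorem marks_mk (X : FinGSet G) (H : Subgroup G) :
    marks G (mk X) (ConjSub.mk H) = FinGSet.fixedCard H X :=
  congrFun (liftAlgHom_mk _ _ X) _

theorem card_lt_of_marks_ne_zero [Finite G] {H K : Subgroup G}
    (h : marks G (mk (FinGSet.orbit H)) (ConjSub.mk K) ≠ 0)
    (hne : ConjSub.mk K ≠ ConjSub.mk H) : Nat.card K < Nat.card H := by
  rw [marks_mk, Nat.cast_ne_zero] at h
  obtain ⟨g, hg⟩ := FinGSet.exists_of_fixedCard_ne_zero h
  have hc : Nat.card (MulAut.conj g • H : Subgroup G) = Nat.card H :=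
    (Nat.card_congr (Subgroup.equivSMul (MulAut.conj g) H).toEquiv).symm
  rw [← hc]
  refine lt_of_le_of_ne (Subgroup.card_le_of_le hg) fun he => hne ?_
  exact (Quotient.sound ⟨g, Subgroup.eq_of_le_of_card_ge hg he.ge⟩ :
    ConjSub.mk H = ConjSub.mk K).symm

open Classical in
theorem single_mem_range [Finite G] (n : ℕ) : ∀ H : Subgroup G, Nat.card H = n →
    (Pi.single (ConjSub.mk H) 1 : ConjSub G → ℚ) ∈ LinearMap.range (marks G).toLinearMap := by
  induction n using Nat.strong_induction_on with
  | _ n ih =>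
    rintro H rfl
    have := Fintype.ofFinite (ConjSub G)
    set f : ConjSub G → ℚ := marks G (mk (FinGSet.orbit H)) with hf
    have hH : f (ConjSub.mk H) ≠ 0 := by
      rw [hf, marks_mk, Nat.cast_ne_zero]
      exact FinGSet.fixedCard_self_ne_zero H
    have hsum : f = f (ConjSub.mk H) • (Pi.single (ConjSub.mk H) 1 : ConjSub G → ℚ)
        + ∑ c ∈ Finset.univ.erase (ConjSub.mk H), f c • (Pi.single c 1 : ConjSub G → ℚ) := by
      rw [Finset.add_sum_erase _ (fun c => f c • (Pi.single c 1 : ConjSub G → ℚ))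
        (Finset.mem_univ _)]
      funext c
      simp [Finset.sum_apply, Pi.single_apply]
    have hrest : ∑ c ∈ Finset.univ.erase (ConjSub.mk H), f c • (Pi.single c 1 : ConjSub G → ℚ) ∈
        LinearMap.range (marks G).toLinearMap := by
      refine Submodule.sum_mem _ fun c hc => ?_
      by_cases h0 : f c = 0
      · rw [h0, zero_smul]
        exact Submodule.zero_mem _
      · refine Submodule.smul_mem _ _ ?_
        induction c using Quotient.inductionOn with
        | h K => exact ih _ (card_lt_of_marks_ne_zero h0 (Finset.ne_of_mem_erase hc)) K rfl
    have hfm : f ∈ LinearMap.range (marks G).toLinearMap :=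
      ⟨mk (FinGSet.orbit H), rfl⟩
    rw [← Submodule.smul_mem_iff _ hH, ← Submodule.add_mem_iff_left _ hrest, ← hsum]
    exact hfm

theorem marks_surjective [Finite G] : Function.Surjective (marks G) := by
  classical
  have := Fintype.ofFinite (ConjSub G)
  intro f
  have hf : f = ∑ c, f c • (Pi.single c 1 : ConjSub G → ℚ) := by
    funext c
    simp [Finset.sum_apply, Pi.single_apply]
  have : f ∈ LinearMap.range (marks G).toLinearMap := by
    rw [hf]
    refine Submodule.sum_mem _ fun c _ => Submodule.smul_mem _ _ ?_
    induction c using Quotient.inductionOn with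
    | h K => exact single_mem_range _ K rfl
  obtain ⟨a, ha⟩ := this
  exact ⟨a, ha⟩

/-- The span of the classes of transitive `G`-sets. -/
noncomputable def orbitSpan (G : Type u) [Group G] [Finite G] : Submodule ℚ (BurnsideRing G) :=
  Submodule.span ℚ (Set.range fun c : ConjSub G => mk (FinGSet.orbit c.out))

theorem mk_orbit_mem [Finite G] (H : Subgroup G) : mk (FinGSet.orbit H) ∈ orbitSpan G := by
  obtain ⟨g, hg⟩ : (ConjSub.mk H).out ≈ H := Quotient.mk_out H
  refine Submodule.subset_span ⟨ConjSub.mk H, (mk_iso ?_).symm⟩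
  have := FinGSet.orbit_iso_conj g (ConjSub.mk H).out
  rw [← hg] at this
  exact (FinGSet.isoSetoid G).symm this

theorem mk_mem [Finite G] (n : ℕ) : ∀ X : FinGSet G, Nat.card X.carrier = n →
    mk X ∈ orbitSpan G := by
  classical
  induction n using Nat.strong_induction_on with
  | _ n ih =>
    rintro X rfl
    rcases isEmpty_or_nonempty X.carrier with hX | ⟨⟨x⟩⟩
    · have h : mk (FinGSet.sum X X) = mk X :=
        mk_iso ⟨Equiv.emptySum X.carrier X.carrier, fun g y => by
          rcases y with y | y
          · exact (hX.false y).elim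
          · rfl⟩
      rw [mk_sum, add_eq_left] at h
      rw [h]
      exact Submodule.zero_mem _
    · have hinv : ∀ (g : G) (y : X.carrier), y ∈ (MulAction.orbit G x)ᶜ →
          g • y ∈ (MulAction.orbit G x)ᶜ := fun g y hy h =>
        hy (by simpa using MulAction.mem_orbit_of_mem_orbit g⁻¹ h)
      let Y : FinGSet G :=
        { carrier := ((MulAction.orbit G x)ᶜ : Set X.carrier)
          action :=
            { smul := fun g y => ⟨g • y.1, hinv g y.1 y.2⟩
              one_smul := fun y => Subtype.ext (one_smul G y.1)
              mul_smul := fun g h y => Subtype.ext (mul_smul g h y.1) } }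
      have h : mk X = mk (FinGSet.orbit (MulAction.stabilizer G x)) + mk Y := by
        rw [← mk_sum]
        refine mk_iso ((FinGSet.isoSetoid G).symm ⟨(Equiv.sumCongr
          (MulAction.orbitEquivQuotientStabilizer G x).symm (Equiv.refl _)).trans
          (Equiv.Set.sumCompl (MulAction.orbit G x)), ?_⟩)
        rintro g (y | y)
        · induction y using QuotientGroup.induction_on with
          | H y => exact mul_smul g y x
        · rfl
      rw [h]
      refine Submodule.add_mem _ (mk_orbit_mem _) (ih _ ?_ Y rfl)
      exact Finite.card_subtype_lt (x := x) (fun hx => hx (MulAction.mem_orbit_self x))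

theorem orbitSpan_eq_top [Finite G] : orbitSpan G = ⊤ := by
  rw [eq_top_iff]
  rintro a -
  obtain ⟨a, rfl⟩ := Ideal.Quotient.mk_surjective a
  induction a using MonoidAlgebra.induction_on with
  | of c =>
    induction c using Quotient.inductionOn with
    | h X => exact mk_mem _ X rfl
  | add a b ha hb =>
    rw [map_add]
    exact Submodule.add_mem _ ha hb
  | smul r a ha => exact Submodule.smul_mem _ r ha

theorem marks_bijective [Finite G] : Function.Bijective (marks G) := by
  classical
  have := Fintype.ofFinite (ConjSub G)
  refine ⟨?_, marks_surjective⟩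
  have : Module.Finite ℚ (BurnsideRing G) :=
    ⟨⟨(Set.range fun c : ConjSub G => mk (FinGSet.orbit c.out)).toFinset, by
      rw [Set.coe_toFinset]
      exact orbitSpan_eq_top⟩⟩
  have hle : Module.finrank ℚ (BurnsideRing G) ≤ Fintype.card (ConjSub G) := by
    have := finrank_range_le_card (R := ℚ) (fun c : ConjSub G => mk (FinGSet.orbit c.out))
    rwa [Set.finrank, show Submodule.span ℚ _ = (⊤ : Submodule ℚ (BurnsideRing G)) from
      orbitSpan_eq_top, finrank_top] at this
  have hge := LinearMap.finrank_le_finrank_of_surjective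
    (f := (marks G).toLinearMap) marks_surjective
  rw [Module.finrank_fintype_fun_eq_card] at hge
  exact (LinearMap.injective_iff_surjective_of_finrank_eq_finrank
    (f := (marks G).toLinearMap) (by
      rw [Module.finrank_fintype_fun_eq_card]; exact le_antisymm hle hge)).2 marks_surjective

/-- tom Dieck's isomorphism `A_ℚ(G) ≅ C(Sub(G)/G, ℚ)`. -/
noncomputable def tomDieck (G : Type u) [Group G] [Finite G] :
    BurnsideRing G ≃ₐ[ℚ] (ConjSub G → ℚ) :=
  AlgEquiv.ofBijective (marks G) marks_bijective

open Classical in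
/-- The idempotent `e_H^G ∈ A_ℚ(G)` corresponding to the characteristic function of `(H)`. -/
noncomputable def idem [Finite G] (H : Subgroup G) : BurnsideRing G :=
  (tomDieck G).symm (Pi.single (ConjSub.mk H) 1)

end BurnsideRing

/-! ### The action of Burnside rings on a Mackey functor -/

namespace MackeyFunctor

variable {G : Type u} [Group G] (M : MackeyFunctor.{u, v} G)

/-- For `S ≤ K`, the operator `I_S^K ∘ R_S^K` on `M(G/K)`. -/
def indRes (K : Subgroup G) (S : Subgroup K) : Module.End ℚ (M.obj K) :=
  M.ind (Subgroup.map_subtype_le S) ∘ₗ M.res (Subgroup.map_subtype_le S)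

/-- The operator on `M(G/K)` given by a finite `K`-set `X`. It is the sum over the orbits of `X` of
`I_S^K ∘ R_S^K`, where `S` is the stabilizer of a point of the orbit; the sum is written as one over
all points of `X`, weighted by the inverse length `|S| / |K|` of the orbit. -/
noncomputable def setAct (K : Subgroup G) (X : FinGSet K) : Module.End ℚ (M.obj K) :=
  letI := Fintype.ofFinite X.carrier
  ∑ x : X.carrier, ((Nat.card (MulAction.stabilizer K x) : ℚ) / Nat.card K) •
    M.indRes K (MulAction.stabilizer K x)

theorem setAct_iso (K : Subgroup G) {X Y : FinGSet K} (h : FinGSet.Iso X Y) :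
    M.setAct K X = M.setAct K Y := by
  obtain ⟨f, hf⟩ := h
  let _ := Fintype.ofFinite X.carrier
  let _ := Fintype.ofFinite Y.carrier
  refine Fintype.sum_equiv f _ _ fun x => ?_
  have : MulAction.stabilizer K x = MulAction.stabilizer K (f x) := by
    ext k
    rw [MulAction.mem_stabilizer_iff, MulAction.mem_stabilizer_iff, ← hf, f.apply_eq_iff_eq]
  rw [this]

theorem setAct_sum (K : Subgroup G) (X Y : FinGSet K) :
    M.setAct K (FinGSet.sum X Y) = M.setAct K X + M.setAct K Y := by
  let _ := Fintype.ofFinite X.carrier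
  let _ := Fintype.ofFinite Y.carrier
  let T (S : Subgroup K) : Module.End ℚ (M.obj K) :=
    ((Nat.card S : ℚ) / Nat.card K) • M.indRes K S
  have h1 : M.setAct K (FinGSet.sum X Y) = ∑ z : X.carrier ⊕ Y.carrier,
      T (MulAction.stabilizer K (z : (FinGSet.sum X Y).carrier)) :=
    @Fintype.sum_equiv (FinGSet.sum X Y).carrier (X.carrier ⊕ Y.carrier) _
      (Fintype.ofFinite _) _ _ (Equiv.refl _) _ _ fun _ => rfl
  rw [h1, Fintype.sum_sum_type]
  refine congrArg₂ (· + ·) (Finset.sum_congr rfl fun x _ => congrArg T ?_)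
    (Finset.sum_congr rfl fun y _ => congrArg T ?_)
  · ext k
    exact Sum.inl_injective.eq_iff (α := X.carrier) (β := X.carrier ⊕ Y.carrier) (a := k • x)
  · ext k
    exact Sum.inr_injective.eq_iff (α := Y.carrier) (β := X.carrier ⊕ Y.carrier) (a := k • y)

/-- The linear extension of `setAct` to formal combinations of finite `K`-sets. -/
noncomputable def preAct (K : Subgroup G) : ℚ[IsoClass K] →ₗ[ℚ] Module.End ℚ (M.obj K) :=
  Finsupp.linearCombination ℚ (Quotient.lift (M.setAct K) fun _ _ h => M.setAct_iso K h) ∘ₗ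
    (MonoidAlgebra.coeffLinearEquiv ℚ).toLinearMap

theorem preAct_single (K : Subgroup G) (X : FinGSet K) (r : ℚ) :
    M.preAct K (MonoidAlgebra.single (IsoClass.mk X) r) = r • M.setAct K X := by
  exact Finsupp.linearCombination_single ℚ r (IsoClass.mk X)

theorem preAct_eq_zero (K : Subgroup G) (a : ℚ[IsoClass K])
    (ha : a ∈ Ideal.span (burnsideRel K)) : M.preAct K a = 0 := by
  suffices h : ∀ r : ℚ[IsoClass K], M.preAct K (r * a) = 0 by simpa using h 1
  induction ha using Submodule.span_induction with
  | mem a ha =>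
    obtain ⟨X, Y, rfl⟩ := ha
    intro r
    induction r using MonoidAlgebra.induction_on with
    | of c =>
      induction c using Quotient.inductionOn with
      | h Z =>
        have hZ : FinGSet.Iso (FinGSet.prod Z (FinGSet.sum X Y))
            (FinGSet.sum (FinGSet.prod Z X) (FinGSet.prod Z Y)) := by
          refine ⟨Equiv.prodSumDistrib Z.carrier X.carrier Y.carrier, ?_⟩
          rintro g ⟨z, x | y⟩ <;> rfl
        change M.preAct K (MonoidAlgebra.single (IsoClass.mk Z) 1 * _) = 0
        rw [mul_sub, mul_sub, MonoidAlgebra.single_mul_single, MonoidAlgebra.single_mul_single,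
          MonoidAlgebra.single_mul_single, IsoClass.mk_mul, IsoClass.mk_mul, IsoClass.mk_mul,
          map_sub, map_sub, preAct_single, preAct_single, preAct_single, setAct_iso M K hZ,
          setAct_sum]
        simp
    | add r s hr hs => rw [add_mul, map_add, hr, hs, add_zero]
    | smul q r hr => rw [smul_mul_assoc, map_smul, hr, smul_zero]
  | zero => intro r; simp
  | add a b _ _ ha hb => intro r; rw [mul_add, map_add, ha, hb, add_zero]
  | smul s a _ ha => intro r; rw [smul_eq_mul, ← mul_assoc, ha]

/-- The action of the rational Burnside ring `A_ℚ(K)` on `M(G/K)`, the linear extension of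
`[K/S] ↦ I_S^K ∘ R_S^K`. -/
noncomputable def burnsideAct (K : Subgroup G) : BurnsideRing K →ₗ[ℚ] Module.End ℚ (M.obj K) :=
  Submodule.liftQ ((Ideal.span (burnsideRel K)).restrictScalars ℚ) (M.preAct K)
    fun a ha => M.preAct_eq_zero K a ha

theorem burnsideAct_mk (K : Subgroup G) (X : FinGSet K) :
    M.burnsideAct K (BurnsideRing.mk X) = M.setAct K X :=
  (M.preAct_single K X 1).trans (one_smul _ _)

theorem ind_res_conj (K : Subgroup G) {S T : Subgroup G} (hS : S ≤ K) (hT : T ≤ K) (g : G)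
    (hg : g ∈ K) (e : T = MulAut.conj g • S) (m : M.obj K) :
    M.ind hT (M.res hT m) = M.ind hS (M.res hS m) := by
  have eK : K = MulAut.conj g • K := (Subgroup.conj_smul_eq_self_of_mem hg).symm
  have h1 := M.res_conj g hS hT e eK m
  rw [M.conj_self g hg] at h1
  rw [h1, M.ind_conj g hS hT e eK, M.conj_self g hg]

/-- The class `[K/S]` acts as `I_S^K ∘ R_S^K`. -/
theorem burnsideAct_orbit [Finite G] (K : Subgroup G) (S : Subgroup K) :
    M.burnsideAct K (BurnsideRing.mk (FinGSet.orbit S)) = M.indRes K S := by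
  rw [burnsideAct_mk]
  let _ := Fintype.ofFinite (FinGSet.orbit S).carrier
  have key : ∀ x : (FinGSet.orbit S).carrier,
      ((Nat.card (MulAction.stabilizer K x) : ℚ) / Nat.card K) •
        M.indRes K (MulAction.stabilizer K x) =
      ((Nat.card S : ℚ) / Nat.card K) • M.indRes K S := by
    intro x
    induction x using QuotientGroup.induction_on with
    | H k =>
      have hs : MulAction.stabilizer K ((k : K ⧸ S)) = MulAut.conj k • S := by
        ext a
        rw [MulAction.mem_stabilizer_iff, mem_conj_iff, ← S.inv_mem_iff,
          MulAction.Quotient.smul_mk, QuotientGroup.eq]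
        simp [mul_assoc]
      have hc : Nat.card (MulAut.conj k • S : Subgroup K) = Nat.card S :=
        (Nat.card_congr (Subgroup.equivSMul (MulAut.conj k) S).toEquiv).symm
      change ((Nat.card (MulAction.stabilizer K (k : K ⧸ S)) : ℚ) / Nat.card K) •
        M.indRes K (MulAction.stabilizer K (k : K ⧸ S)) = _
      rw [hs, hc]
      congr 1
      ext m
      refine M.ind_res_conj K _ _ (k : G) k.2 ?_ m
      ext a
      rw [mem_conj_iff, Subgroup.mem_map, Subgroup.mem_map]
      constructor
      · rintro ⟨b, hb, rfl⟩
        exact ⟨_, mem_conj_iff.1 hb, rfl⟩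
      · rintro ⟨b, hb, hab⟩
        refine ⟨k * b * k⁻¹, mem_conj_iff.2 (by simpa [mul_assoc] using hb), ?_⟩
        have hab' : (b : G) = (k : G)⁻¹ * a * k := hab
        simp [hab', mul_assoc]
  rw [setAct, Finset.sum_congr rfl fun x _ => key x, Finset.sum_const, ← Nat.cast_smul_eq_nsmul ℚ,
    smul_smul, Finset.card_univ, ← Nat.card_eq_fintype_card]
  have hcard : Nat.card K = Nat.card (K ⧸ S) * Nat.card S := S.card_eq_card_quotient_mul_card_subgroup
  have hpos : (Nat.card K : ℚ) ≠ 0 := Nat.cast_ne_zero.2 Nat.card_pos.ne'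
  have : (Nat.card (FinGSet.orbit S).carrier : ℚ) * ((Nat.card S : ℚ) / Nat.card K) = 1 := by
    rw [← mul_div_assoc, div_eq_one_iff_eq hpos, hcard, Nat.cast_mul]
    rfl
  rw [this, one_smul]

/-- `M = e_H^G M`, that is, `R_K^G(e_H^G) M(G/K) = M(G/K)` for all subgroups `K` of `G`. -/
def IsIdemPart [Finite G] (H : Subgroup G) : ObjectProperty (MackeyFunctor.{u, v} G) := fun M =>
  ∀ K : Subgroup G, LinearMap.range (M.burnsideAct K (BurnsideRing.res K (BurnsideRing.idem H))) = ⊤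

/-- The full subcategory `e_H^G Mack_ℚ(G)`. -/
abbrev IdemMackey [Finite G] (H : Subgroup G) := (IsIdemPart.{u, v} H).FullSubcategory

end MackeyFunctor

/-! ### Evaluation at `G/H` and the functor `F_H` -/

/-- The Weyl group `W_G H = N_G H / H`. -/
abbrev WeylGroup {G : Type u} [Group G] (H : Subgroup G) : Type u :=
  Subgroup.normalizer (H : Set G) ⧸ H.subgroupOf (Subgroup.normalizer (H : Set G))

theorem conj_eq_of_mem_normalizer {G : Type u} [Group G] {H : Subgroup G} {n : G}
    (hn : n ∈ Subgroup.normalizer (H : Set G)) : H = MulAut.conj n • H := by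
  ext x
  rw [mem_conj_iff]
  have := Subgroup.mem_normalizer_iff.1 (inv_mem hn) x
  simpa using this

namespace MackeyFunctor

variable {G : Type u} [Group G]

/-- The representation of `W_G H` on `M(G/H)`, in which the class of `n` acts as `C_n`. -/
def weylRep (M : MackeyFunctor.{u, v} G) (H : Subgroup G) :
    Representation ℚ (WeylGroup H) (M.obj H) :=
  QuotientGroup.lift (H.subgroupOf (Subgroup.normalizer (H : Set G)))
    { toFun := fun n => M.conj (n : G) (conj_eq_of_mem_normalizer n.2)
      map_one' := by
        ext m
        exact M.conj_self 1 H.one_mem _ m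
      map_mul' := fun a b => by
        ext m
        exact M.conj_mul (a : G) (b : G) _ _ _ m }
    (by
      intro n hn
      ext m
      exact M.conj_self (n : G) (Subgroup.mem_subgroupOf.1 hn) _ m)

/-- Evaluation at `G/H`, as a functor to representations of `W_G H`. -/
def evalRep (H : Subgroup G) : MackeyFunctor.{u, v} G ⥤ Rep.{v} ℚ (WeylGroup H) where
  obj M := Rep.of (M.weylRep H)
  map {M N} f := Rep.ofHom
    { f.app H with
      isIntertwining' := by
        intro w
        induction w using QuotientGroup.induction_on with
        | H n =>
          ext m
          exact f.app_conj (n : G) _ m }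

/-- Evaluation at `G/H`, `M ↦ M(G/H)`, as a functor to `ℚ[W_G H]`-modules. -/
noncomputable def eval (H : Subgroup G) :
    MackeyFunctor.{u, v} G ⥤ ModuleCat.{v} ℚ[WeylGroup H] :=
  evalRep H ⋙ Rep.toModuleMonoidAlgebra

/-- The functor `U_H : e_H^G Mack_ℚ(G) ⥤ ℚ[W_G H]-mod`, `M ↦ M(G/H)`. -/
noncomputable def U [Finite G] (H : Subgroup G) :
    IdemMackey.{u, v} H ⥤ ModuleCat.{v} ℚ[WeylGroup H] :=
  ObjectProperty.ι _ ⋙ eval H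

/-- The set `(G/K)^H` of `H`-fixed points of `G/K`. -/
abbrev FixPts (H K : Subgroup G) : Type u := {σ : G ⧸ K // ∀ h ∈ H, h • σ = σ}

namespace FixPts

variable {H : Subgroup G}

/-- The left action of `n ∈ N_G H` on `(G/K)^H`. -/
def lmul {K : Subgroup G} (n : Subgroup.normalizer (H : Set G)) (σ : FixPts H K) : FixPts H K :=
  ⟨(n : G) • σ.1, fun h hh => by
    have h1 : (n : G)⁻¹ * h * n ∈ H := by
      rw [← mem_conj_iff, ← conj_eq_of_mem_normalizer n.2]
      exact hh
    have h2 := σ.2 _ h1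
    rwa [mul_assoc, mul_smul, inv_smul_eq_iff, mul_smul] at h2⟩

/-- The map `(G/K)^H → (G/A)^H` induced by the projection `G/K → G/A`, for `K ≤ A`. -/
def proj {K A : Subgroup G} (hKA : K ≤ A) (σ : FixPts H K) : FixPts H A :=
  ⟨Subgroup.quotientMapOfLE hKA σ.1, fun h hh => by
    obtain ⟨σ, hσ⟩ := σ
    induction σ using QuotientGroup.induction_on with
    | H g => exact congrArg (Subgroup.quotientMapOfLE hKA) (hσ h hh)⟩

/-- For `K' = g K g⁻¹`, the map `(G/K')^H → (G/K)^H` induced by the `G`-map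
`G/K' → G/K`, `x K' ↦ x g K`. -/
def rmul (g : G) {K K' : Subgroup G} (e : K' = MulAut.conj g • K) (σ : FixPts H K') :
    FixPts H K :=
  ⟨Quotient.map' (s₁ := QuotientGroup.leftRel K') (s₂ := QuotientGroup.leftRel K) (· * g)
    (fun a b hab => by
      rw [QuotientGroup.leftRel_apply] at hab ⊢
      rw [e, mem_conj_iff] at hab
      simpa [mul_assoc] using hab) σ.1, fun h hh => by
    obtain ⟨σ, hσ⟩ := σ
    induction σ using QuotientGroup.induction_on with
    | H x =>
      have h1 := hσ h hh
      rw [MulAction.Quotient.smul_mk, QuotientGroup.eq, e, mem_conj_iff] at h1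
      change h • ((x * g : G) : G ⧸ K) = ((x * g : G) : G ⧸ K)
      rw [MulAction.Quotient.smul_mk, QuotientGroup.eq]
      simpa [mul_assoc] using h1⟩

/-- The point of `(G/K)^H` given by an element `g`. -/
def mk {K : Subgroup G} (g : G) (hg : ∀ h ∈ H, h • (g : G ⧸ K) = g) : FixPts H K := ⟨g, hg⟩

theorem exists_mk {K : Subgroup G} (σ : FixPts H K) : ∃ g hg, σ = mk g hg := by
  obtain ⟨σ, hσ⟩ := σ
  induction σ using QuotientGroup.induction_on with
  | H g => exact ⟨g, hσ, rfl⟩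

theorem eq_iff {K : Subgroup G} {σ τ : FixPts H K} (a b : G) (ha : σ.1 = a) (hb : τ.1 = b) :
    σ = τ ↔ a⁻¹ * b ∈ K := by
  rw [← QuotientGroup.eq, Subtype.ext_iff, ha, hb]

theorem proj_lmul {K A : Subgroup G} (hKA : K ≤ A) (n : Subgroup.normalizer (H : Set G))
    (σ : FixPts H K) : proj hKA (lmul n σ) = lmul n (proj hKA σ) := by
  obtain ⟨g, hg, rfl⟩ := exists_mk σ
  rfl

theorem rmul_lmul (g : G) {K K' : Subgroup G} (e : K' = MulAut.conj g • K)
    (n : Subgroup.normalizer (H : Set G)) (σ : FixPts H K') :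
    rmul g e (lmul n σ) = lmul n (rmul g e σ) := by
  obtain ⟨x, hx, rfl⟩ := exists_mk σ
  rw [eq_iff (n * x * g) (n * (x * g)) rfl rfl]
  simp [mul_assoc]

theorem proj_rmul (g : G) {K A K' A' : Subgroup G} (h : K ≤ A) (h' : K' ≤ A')
    (eK : K' = MulAut.conj g • K) (eA : A' = MulAut.conj g • A) (σ : FixPts H K') :
    proj h (rmul g eK σ) = rmul g eA (proj h' σ) := by
  obtain ⟨x, hx, rfl⟩ := exists_mk σ
  rfl

theorem rmul_injective (g : G) {K K' : Subgroup G} (e : K' = MulAut.conj g • K) :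
    Function.Injective (rmul (H := H) g e) := by
  intro σ τ h
  obtain ⟨x, hx, rfl⟩ := exists_mk σ
  obtain ⟨y, hy, rfl⟩ := exists_mk τ
  rw [eq_iff (x * g) (y * g) rfl rfl] at h
  rw [eq_iff x y rfl rfl, e, mem_conj_iff]
  simpa [mul_assoc] using h

theorem rmul_surjective (g : G) {K K' : Subgroup G} (e : K' = MulAut.conj g • K) :
    Function.Surjective (rmul (H := H) g e) := by
  intro σ
  have e' : K = MulAut.conj g⁻¹ • K' := by
    rw [e, smul_smul, ← map_mul, inv_mul_cancel, map_one, one_smul]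
  refine ⟨rmul g⁻¹ e' σ, ?_⟩
  obtain ⟨x, hx, rfl⟩ := exists_mk σ
  rw [eq_iff (x * g⁻¹ * g) x rfl rfl]
  simp

theorem lmul_bijective {K : Subgroup G} (n : Subgroup.normalizer (H : Set G)) :
    Function.Bijective (lmul (H := H) (K := K) n) := by
  refine ⟨fun σ τ h => ?_, fun σ => ⟨lmul n⁻¹ σ, ?_⟩⟩
  · exact Subtype.ext (smul_left_cancel (n : G) (congrArg Subtype.val h))
  · exact Subtype.ext (smul_inv_smul (n : G) σ.1)

end FixPts

section FreeFunctor

variable {H : Subgroup G}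

/-- The value at `G/K` of `F_H V`: the invariants `(⨁_{σ ∈ (G/K)^H} V)^{W_G H}`, that is,
`(ℚ[(G/K)^H] ⊗ V)^{W_G H}`, written as families `y` of elements of `V` indexed by `(G/K)^H` with
`y (n σ) = n (y σ)` for all `n ∈ N_G H`. -/
def freeObj (V : Rep.{v} ℚ (WeylGroup H)) (K : Subgroup G) :
    Submodule ℚ (FixPts H K → V) where
  carrier := {y | ∀ (n : Subgroup.normalizer (H : Set G)) (σ : FixPts H K),
    y (FixPts.lmul n σ) = V.ρ (n : WeylGroup H) (y σ)}
  add_mem' := by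
    intro a b ha hb n σ
    simp [ha n σ, hb n σ]
  zero_mem' := by
    intro n σ
    simp
  smul_mem' := by
    intro c a ha n σ
    simp [ha n σ]

/-- Restriction in `F_H V`: `(R y)_σ = y_{α σ}`, with `α` the projection. -/
def freeRes (V : Rep.{v} ℚ (WeylGroup H)) {K A : Subgroup G} (hKA : K ≤ A) :
    freeObj V A →ₗ[ℚ] freeObj V K where
  toFun y := ⟨fun σ => y.1 (FixPts.proj hKA σ), fun n σ => by
    change y.1 (FixPts.proj hKA (FixPts.lmul n σ)) = _
    rw [FixPts.proj_lmul, y.2]⟩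
  map_add' _ _ := rfl
  map_smul' _ _ := rfl

/-- Conjugation in `F_H V` is induced by the `G`-map `G/gKg⁻¹ → G/K`, `x (g K g⁻¹) ↦ x g K`. -/
def freeConj (V : Rep.{v} ℚ (WeylGroup H)) (g : G) {K K' : Subgroup G}
    (e : K' = MulAut.conj g • K) : freeObj V K →ₗ[ℚ] freeObj V K' where
  toFun y := ⟨fun σ => y.1 (FixPts.rmul g e σ), fun n σ => by
    change y.1 (FixPts.rmul g e (FixPts.lmul n σ)) = _
    rw [FixPts.rmul_lmul, y.2]⟩
  map_add' _ _ := rfl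
  map_smul' _ _ := rfl

noncomputable instance [Finite G] (K : Subgroup G) : Fintype (FixPts H K) := Fintype.ofFinite _

open Classical in
/-- Induction in `F_H V`: `(I y)_τ = ∑_{α σ = τ} y_σ`, with `α` the projection. -/
noncomputable def freeInd [Finite G] (V : Rep.{v} ℚ (WeylGroup H)) {K A : Subgroup G}
    (hKA : K ≤ A) : freeObj V K →ₗ[ℚ] freeObj V A where
  toFun y := ⟨fun τ => ∑ σ with FixPts.proj hKA σ = τ, y.1 σ, fun n τ => by
    rw [map_sum]
    symm
    refine Finset.sum_bij (fun σ _ => FixPts.lmul n σ) ?_ ?_ ?_ ?_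
    · intro σ hσ
      simp only [Finset.mem_filter, Finset.mem_univ, true_and] at hσ ⊢
      rw [FixPts.proj_lmul, hσ]
    · exact fun _ _ _ _ h => (FixPts.lmul_bijective n).1 h
    · intro σ hσ
      obtain ⟨ρ, rfl⟩ := (FixPts.lmul_bijective n).2 σ
      simp only [Finset.mem_filter, Finset.mem_univ, true_and] at hσ
      rw [FixPts.proj_lmul] at hσ
      exact ⟨ρ, by simpa using (FixPts.lmul_bijective n).1 hσ, rfl⟩
    · exact fun σ _ => (y.2 n σ).symm⟩
  map_add' a b := by
    ext τ
    exact Finset.sum_add_distrib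
  map_smul' c a := by
    ext τ
    exact (Finset.smul_sum (r := c) (f := a.1)).symm

open Classical in
theorem freeInd_apply [Finite G] (V : Rep.{v} ℚ (WeylGroup H)) {K A : Subgroup G}
    (hKA : K ≤ A) (y : freeObj V K) (τ : FixPts H A) :
    (freeInd V hKA y).1 τ = ∑ σ with FixPts.proj hKA σ = τ, y.1 σ := rfl

theorem free_mackey [Finite G] (V : Rep.{v} ℚ (WeylGroup H)) {K L A : Subgroup G} (hK : K ≤ A)
    (hL : L ≤ A) (s : Finset G) (hs : IsDoubleCosetReps K A L s) (y : freeObj V L) :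
    freeRes V hK (freeInd V hL y) = ∑ x ∈ s,
      freeInd V (K := K ⊓ MulAut.conj x • L) (A := K) inf_le_left
        (freeConj V x (conj_inf x K L)
          (freeRes V (K := L ⊓ MulAut.conj x⁻¹ • K) (A := L) inf_le_left y)) := by
  classical
  apply Subtype.ext
  funext σ
  rw [AddSubmonoidClass.coe_finsetSum, Finset.sum_apply]
  change ∑ τ with FixPts.proj hL τ = FixPts.proj hK σ, y.1 τ = ∑ x ∈ s,
    ∑ ρ : FixPts H (K ⊓ MulAut.conj x • L) with FixPts.proj inf_le_left ρ = σ,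
      y.1 (FixPts.proj inf_le_left (FixPts.rmul x (conj_inf x K L) ρ))
  rw [Finset.sum_sigma']
  symm
  refine Finset.sum_bij (fun p _ => FixPts.proj inf_le_left
    (FixPts.rmul p.1 (conj_inf p.1 K L) p.2)) ?_ ?_ ?_ ?_
  · rintro ⟨x, ρ⟩ hp
    simp only [Finset.mem_sigma, Finset.mem_filter, Finset.mem_univ, true_and] at hp ⊢
    obtain ⟨hx, rfl⟩ := hp
    obtain ⟨g, hg, rfl⟩ := FixPts.exists_mk ρ
    rw [FixPts.eq_iff (g * x) g rfl rfl]
    simpa [mul_assoc] using hs.1 x hx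
  · rintro ⟨x, ρ⟩ hp ⟨x', ρ'⟩ hp' h
    simp only [Finset.mem_sigma, Finset.mem_filter, Finset.mem_univ, true_and] at hp hp'
    obtain ⟨hx, rfl⟩ := hp
    obtain ⟨hx', hρ⟩ := hp'
    obtain ⟨g, hg, rfl⟩ := FixPts.exists_mk ρ
    obtain ⟨g', hg', rfl⟩ := FixPts.exists_mk ρ'
    rw [FixPts.eq_iff (g * x) (g' * x') rfl rfl] at h
    rw [FixPts.eq_iff g' g rfl rfl] at hρ
    have hxx : x = x' := by
      obtain ⟨z, -, hz⟩ := hs.2 x' (hs.1 x' hx')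
      rw [hz x ⟨hx, g'⁻¹ * g, hρ, (g * x)⁻¹ * (g' * x'), h, by group⟩,
        hz x' ⟨hx', 1, K.one_mem, 1, L.one_mem, by group⟩]
    subst hxx
    have : FixPts.mk g hg = FixPts.mk g' hg' := by
      rw [FixPts.eq_iff g g' rfl rfl, Subgroup.mem_inf, mem_conj_iff]
      refine ⟨?_, ?_⟩
      · simpa using K.inv_mem hρ
      · simpa [mul_assoc] using h
    rw [this]
  · intro τ hτ
    simp only [Finset.mem_filter, Finset.mem_univ, true_and] at hτ
    obtain ⟨t, ht, rfl⟩ := FixPts.exists_mk τ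
    obtain ⟨g, hg, rfl⟩ := FixPts.exists_mk σ
    rw [FixPts.eq_iff t g rfl rfl] at hτ
    have hA : g⁻¹ * t ∈ A := by simpa using A.inv_mem hτ
    obtain ⟨x, ⟨hx, k, hk, l, hl, hkl⟩, -⟩ := hs.2 _ hA
    have ht' : t = g * k * x * l := by
      rw [mul_assoc, mul_assoc, ← mul_assoc k, ← hkl]
      group
    subst ht'
    have hfix : ∀ h ∈ H, h • ((g * k : G) : G ⧸ (K ⊓ MulAut.conj x • L)) = (g * k : G) := by
      intro h hh
      have h1 := hg h hh
      have h2 := ht h hh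
      rw [MulAction.Quotient.smul_mk, QuotientGroup.eq] at h1 h2 ⊢
      rw [Subgroup.mem_inf, mem_conj_iff]
      refine ⟨?_, ?_⟩
      · have := K.mul_mem (K.mul_mem (K.inv_mem hk) h1) hk
        simpa [mul_assoc] using this
      · have := L.mul_mem (L.mul_mem hl h2) (L.inv_mem hl)
        simpa [mul_assoc] using this
    refine ⟨⟨x, FixPts.mk (g * k) hfix⟩, ?_, ?_⟩
    · simp only [Finset.mem_sigma, Finset.mem_filter, Finset.mem_univ, true_and]
      refine ⟨hx, ?_⟩
      rw [FixPts.eq_iff (g * k) g rfl rfl]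
      simpa using hk
    · rw [FixPts.eq_iff (g * k * x) (g * k * x * l) rfl rfl]
      simpa [mul_assoc] using hl
  · exact fun _ _ => rfl

/-- The Mackey functor `F_H V`, for a representation `V` of `W_G H`. -/
noncomputable def free [Finite G] (V : Rep.{v} ℚ (WeylGroup H)) :
    MackeyFunctor.{u, max u v} G where
  obj K := freeObj V K
  res h := freeRes V h
  ind h := freeInd V h
  conj g _ _ e := freeConj V g e
  res_self K y := by
    apply Subtype.ext
    funext σ
    obtain ⟨g, hg, rfl⟩ := FixPts.exists_mk σ
    rfl
  ind_self K y := by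
    classical
    apply Subtype.ext
    funext σ
    rw [freeInd_apply]
    have : ∀ τ : FixPts H K, FixPts.proj le_rfl τ = τ := by
      intro τ
      obtain ⟨g, hg, rfl⟩ := FixPts.exists_mk τ
      rfl
    simp [this, Finset.filter_eq']
  conj_self {K} k hk e y := by
    apply Subtype.ext
    funext σ
    refine congrArg y.1 ?_
    obtain ⟨g, hg, rfl⟩ := FixPts.exists_mk σ
    rw [FixPts.eq_iff (g * k) g rfl rfl]
    simpa using hk
  res_trans h1 h2 y := by
    apply Subtype.ext
    funext σ
    refine congrArg y.1 ?_
    obtain ⟨g, hg, rfl⟩ := FixPts.exists_mk σ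
    rfl
  ind_trans {L K A} h1 h2 y := by
    classical
    apply Subtype.ext
    funext τ
    simp only [freeInd_apply]
    rw [← Finset.sum_fiberwise_of_maps_to (g := FixPts.proj h1)
      (t := Finset.univ.filter fun σ => FixPts.proj h2 σ = τ)]
    · refine Finset.sum_congr rfl fun σ hσ => Finset.sum_congr ?_ fun _ _ => rfl
      ext ρ
      simp only [Finset.mem_filter, Finset.mem_univ, true_and] at hσ ⊢
      refine and_iff_right_of_imp ?_
      rintro rfl
      rw [← hσ]
      obtain ⟨g, hg, rfl⟩ := FixPts.exists_mk ρ
      rfl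
    · intro ρ hρ
      simp only [Finset.mem_filter, Finset.mem_univ, true_and] at hρ ⊢
      rw [← hρ]
      obtain ⟨g, hg, rfl⟩ := FixPts.exists_mk ρ
      rfl
  conj_mul g h _ _ _ e e' e'' y := by
    apply Subtype.ext
    funext σ
    refine congrArg y.1 ?_
    obtain ⟨x, hx, rfl⟩ := FixPts.exists_mk σ
    rw [FixPts.eq_iff (x * (g * h)) (x * g * h) rfl rfl]
    simp [mul_assoc]
  res_conj g _ _ _ _ h h' eK eH y := by
    apply Subtype.ext
    funext σ
    exact congrArg y.1 (FixPts.proj_rmul g h h' eK eH σ).symm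
  ind_conj g K A K' A' h h' eK eA y := by
    classical
    apply Subtype.ext
    funext τ
    change (freeInd V h' (freeConj V g eK y)).1 τ = (freeInd V h y).1 (FixPts.rmul g eA τ)
    rw [freeInd_apply, freeInd_apply]
    refine Finset.sum_bij (fun σ _ => FixPts.rmul g eK σ) ?_ ?_ ?_ ?_
    · intro σ hσ
      simp only [Finset.mem_filter, Finset.mem_univ, true_and] at hσ ⊢
      rw [FixPts.proj_rmul g h h' eK eA, hσ]
    · exact fun _ _ _ _ e => FixPts.rmul_injective g eK e
    · intro σ hσ
      obtain ⟨ρ, rfl⟩ := FixPts.rmul_surjective g eK σ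
      simp only [Finset.mem_filter, Finset.mem_univ, true_and] at hσ
      rw [FixPts.proj_rmul g h h' eK eA] at hσ
      exact ⟨ρ, by simpa using FixPts.rmul_injective g eA hσ, rfl⟩
    · exact fun _ _ => rfl
  mackey hK hL s hs y := free_mackey V hK hL s hs y

/-- The map `F_H V (G/K) → F_H V' (G/K)` induced by a morphism `V → V'`. -/
def freeMap {V V' : Rep.{v} ℚ (WeylGroup H)} (f : V ⟶ V') (K : Subgroup G) :
    freeObj V K →ₗ[ℚ] freeObj V' K where
  toFun y := ⟨fun σ => f.hom (y.1 σ), fun n σ => by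
    change f.hom (y.1 (FixPts.lmul n σ)) = V'.ρ (n : WeylGroup H) (f.hom (y.1 σ))
    rw [y.2, Rep.hom_comm_apply]⟩
  map_add' a b := by
    ext σ
    exact map_add f.hom _ _
  map_smul' c a := by
    ext σ
    exact map_smul f.hom c _

/-- `V ↦ F_H V` as a functor on representations of `W_G H`. -/
noncomputable def freeRep [Finite G] (H : Subgroup G) :
    Rep.{v} ℚ (WeylGroup H) ⥤ MackeyFunctor.{u, max u v} G where
  obj V := free V
  map {V V'} f :=
    { app := freeMap f
      app_res := fun _ _ => rfl
      app_ind := fun h y => by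
        classical
        apply Subtype.ext
        funext τ
        exact map_sum f.hom _ _
      app_conj := fun _ _ _ _ _ => rfl }

/-- The functor `F_H` from `ℚ[W_G H]`-modules to rational `G`-Mackey functors. -/
noncomputable def F [Finite G] (H : Subgroup G) :
    ModuleCat.{v} ℚ[WeylGroup H] ⥤ MackeyFunctor.{u, max u v} G :=
  Rep.ofModuleMonoidAlgebra ⋙ freeRep H

end FreeFunctor

end MackeyFunctor

end RatMackey

namespace RatMackey

/-! The ring `A_ℚ(G)` acts on each `M(G/K)` through its restriction to `A_ℚ(K)` (`gact`). This
action is multiplicative (`gact_mul`), commutes with restriction, induction and conjugation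
(`res_gact`, `ind_gact`, `conj_gact`), and is natural in `M` (`Hom.app_gact`). Since marks determine
elements of the Burnside ring, `a * e_H` is `e_H` times the mark of `a` at `H`
(`BurnsideRing.mul_idem`). The `e_H` are therefore orthogonal idempotents with sum 1, which splits
the category into a product, and on `M = e_H M` each `a` acts as a scalar.

For `M = e_H M` two facts carry the first half. The value `M(G/K)` vanishes unless `K` contains a
conjugate of `H`, because the restriction of `e_H` to `K` then has no nonzero mark
(`IsIdemPart.eq_zero`). Moreover `[G/H]` acts on `M(G/K)` as the nonzero scalar `|(G/H)^H|`, while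
it is also a combination of the operators `I ∘ R` through `K ∩ gHg⁻¹`, of which only those with
`gHg⁻¹ ≤ K` survive. So `M` is both generated by and detected on the conjugates of `H`
(`IsIdemPart.mem_of_avg`).

The unit `M ⟶ F_H(M(G/H))` sends `m` to the family of its pullbacks along the `G`-maps `G/H → G/K`,
which are indexed by `(G/K)^H`. It commutes with induction because the Mackey formula at a conjugate
of `H` loses every term that factors through a proper subgroup (`IsIdemPart.resConj_ind`). It is
injective by detection. It is surjective by generation, since `F_H V` itself lies in the `e_H`-part
(`free_gact`), once surjectivity at `G/H` is known; there a family is determined by its base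
component, as `(G/H)^H = W_G H`. The same remark makes the counit an isomorphism.

Throughout, sums over double cosets or orbits are rewritten as weighted sums over group elements or
points, so that no compatible choice of representatives is needed. -/

/-! ### Double cosets and the averaged Mackey formula -/

theorem exists_doubleCosetReps {G : Type u} [Group G] [Finite G] {K H L : Subgroup G}
    (hK : K ≤ H) (hL : L ≤ H) : ∃ s : Finset G, IsDoubleCosetReps K H L s := by
  classical
  have := Fintype.ofFinite G
  let S := DoubleCoset.setoid (K : Set G) (L : Set G)
  let r : G → G := fun h => (Quotient.mk S h).out
  have hr : ∀ h, ∃ k ∈ K, ∃ l ∈ L, h = k * r h * l := fun h =>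
    DoubleCoset.rel_iff.1 (Quotient.mk_out (s := S) h)
  have hrr : ∀ h k l, k ∈ K → l ∈ L → r (k * h * l) = r h := fun h k l hk hl =>
    congrArg Quotient.out (Quotient.sound (s := S) (DoubleCoset.rel_iff.2
      ⟨k⁻¹, K.inv_mem hk, l⁻¹, L.inv_mem hl, by group⟩))
  -- The double cosets are taken in all of `G`. Because `K, L ≤ H`, the class of an element of `H`
  -- stays inside `H`, and so does its chosen representative.
  refine ⟨(Finset.univ.filter (· ∈ H)).image r, ?_, fun h hh => ⟨r h, ⟨?_, hr h⟩, ?_⟩⟩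
  · intro x hx
    obtain ⟨h, hh, rfl⟩ := Finset.mem_image.1 hx
    obtain ⟨k, hk, l, hl, e⟩ := hr h
    have : r h = k⁻¹ * h * l⁻¹ := by
      rw [eq_mul_inv_iff_mul_eq, eq_inv_mul_iff_mul_eq, ← mul_assoc, ← e]
    rw [this]
    exact H.mul_mem (H.mul_mem (H.inv_mem (hK hk)) (by simpa using hh)) (H.inv_mem (hL hl))
  · exact Finset.mem_image.2 ⟨h, by simpa using hh, rfl⟩
  · rintro x ⟨hx, k, hk, l, hl, rfl⟩
    obtain ⟨h', -, rfl⟩ := Finset.mem_image.1 hx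
    obtain ⟨k', hk', l', hl', e⟩ := hr h'
    rw [hrr _ _ _ hk hl, ← hrr (r h') k' l' hk' hl', ← e]

open Classical in
/-- The map `(x, k, l) ↦ k x l` from `s × K × L`, with `s` a system of representatives of the
double cosets, has fibres of order `|K ∩ hLh⁻¹|`. -/
theorem IsDoubleCosetReps.card_fiber {G : Type u} [Group G] [Finite G] {K H L : Subgroup G}
    [Fintype K] [Fintype L] {s : Finset G} (hs : IsDoubleCosetReps K H L s) {h : G} (hh : h ∈ H) :
    ((s ×ˢ (Finset.univ : Finset (K × L))).filter
      fun p => (p.2.1 : G) * p.1 * p.2.2 = h).card =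
      Nat.card (K ⊓ MulAut.conj h • L : Subgroup G) := by
  have := Fintype.ofFinite (K ⊓ MulAut.conj h • L : Subgroup G)
  obtain ⟨x, ⟨hx, k, hk, l, hl, e⟩, huniq⟩ := hs.2 h hh
  rw [Nat.card_eq_fintype_card, ← Finset.card_univ]
  symm
  -- The group `K ∩ hLh⁻¹` acts simply transitively on the solutions of `k x l = h`: `u` sends the
  -- given solution to `(u k, l (h⁻¹ u h)⁻¹)`.
  refine Finset.card_bij (fun u _ => (x, ⟨⟨u.1 * k, K.mul_mem u.2.1 hk⟩,
    ⟨l * (h⁻¹ * u.1 * h)⁻¹, L.mul_mem hl (L.inv_mem (mem_conj_iff.1 u.2.2))⟩⟩)) ?_ ?_ ?_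
  · intro u _
    simp only [Finset.mem_filter, Finset.mem_product, Finset.mem_univ, and_true]
    refine ⟨hx, ?_⟩
    have : u.1 * k * x * (l * (h⁻¹ * u.1 * h)⁻¹) = u.1 * (k * x * l) * h⁻¹ * u.1⁻¹ * h := by group
    rw [this, ← e]
    group
  · intro u _ u' _ huu
    exact Subtype.ext (mul_right_cancel (congrArg (fun p => (p.2.1 : G)) huu))
  · rintro ⟨x', ⟨k', hk'⟩, ⟨l', hl'⟩⟩ hp
    simp only [Finset.mem_filter, Finset.mem_product, Finset.mem_univ, and_true] at hp
    obtain ⟨hx', e'⟩ := hp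
    obtain rfl : x' = x := huniq x' ⟨hx', k', hk', l', hl', e'.symm⟩
    have hu : h⁻¹ * (k' * k⁻¹) * h = l'⁻¹ * l := by
      have h1 : h⁻¹ * k' = l'⁻¹ * x'⁻¹ := by rw [← e']; group
      have h2 : k⁻¹ * h = x' * l := by rw [e]; group
      rw [← mul_assoc, h1, mul_assoc, h2]
      group
    refine ⟨⟨k' * k⁻¹, K.mul_mem hk' (K.inv_mem hk), mem_conj_iff.2 ?_⟩, Finset.mem_univ _, ?_⟩
    · rw [hu]
      exact L.mul_mem (L.inv_mem hl') hl
    · simp [hu]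

namespace MackeyFunctor

variable {G : Type u} [Group G] (M : MackeyFunctor.{u, v} G)

/-- Conjugation invariance of the terms of the double coset formula. -/
theorem ind_conj_res_mul {K L A B A' B' : Subgroup G} (k h l : G) (hk : k ∈ K) (hl : l ∈ L)
    (hA : A ≤ L) (hA' : A' ≤ L) (hB : B ≤ K) (hB' : B' ≤ K) (e : B = MulAut.conj h • A)
    (e' : B' = MulAut.conj (k * h * l) • A') (eA : A = MulAut.conj l • A') (m : M.obj L) :
    M.ind hB' (M.conj (k * h * l) e' (M.res hA' m)) = M.ind hB (M.conj h e (M.res hA m)) := by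
  have eB : B' = MulAut.conj k • B := by
    rw [e', e, eA, smul_smul, smul_smul, ← map_mul, ← map_mul, mul_assoc]
  have eL : L = MulAut.conj l • L := (Subgroup.conj_smul_eq_self_of_mem hl).symm
  have eK : K = MulAut.conj k • K := (Subgroup.conj_smul_eq_self_of_mem hk).symm
  have e'' : B = MulAut.conj (h * l) • A' := by rw [e, eA, smul_smul, ← map_mul]
  have e3 : B' = MulAut.conj (k * (h * l)) • A' := by rw [← mul_assoc, e']
  have h1 : M.conj (k * h * l) e' (M.res hA' m) = M.conj (k * (h * l)) e3 (M.res hA' m) := by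
    congr 2
    exact mul_assoc k h l
  rw [h1, M.conj_mul k (h * l) e'' eB, M.ind_conj k hB hB' eB eK, M.conj_self k hk,
    M.conj_mul h l eA e, ← M.res_conj l hA' hA eA eL, M.conj_self l hl]

open Classical in
/-- The Mackey formula as an average over all elements of the group. -/
theorem mackey_sum [Finite G] {K L H : Subgroup G} [Fintype H] (hK : K ≤ H) (hL : L ≤ H)
    (m : M.obj L) :
    ((Nat.card K : ℚ) * Nat.card L) • M.res hK (M.ind hL m) = ∑ h : H,
      (Nat.card (K ⊓ MulAut.conj (h : G) • L : Subgroup G) : ℚ) •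
        M.ind (K := K ⊓ MulAut.conj (h : G) • L) (H := K) inf_le_left
          (M.conj (h : G) (conj_inf (h : G) K L)
            (M.res (K := L ⊓ MulAut.conj (h : G)⁻¹ • K) (H := L) inf_le_left m)) := by
  have := Fintype.ofFinite K
  have := Fintype.ofFinite L
  obtain ⟨s, hs⟩ := exists_doubleCosetReps hK hL
  let f : G → M.obj K := fun x => M.ind (K := K ⊓ MulAut.conj x • L) (H := K) inf_le_left
    (M.conj x (conj_inf x K L) (M.res (K := L ⊓ MulAut.conj x⁻¹ • K) (H := L) inf_le_left m))
  have hf : ∀ (k : K) (x : G) (l : L), f (k * x * l) = f x := by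
    intro k x l
    refine M.ind_conj_res_mul (k : G) x l k.2 l.2 _ _ _ _ _ _ ?_ m
    rw [Subgroup.smul_inf, smul_smul, Subgroup.conj_smul_eq_self_of_mem l.2, ← map_mul]
    have : (l : G) * ((k : G) * x * l)⁻¹ = x⁻¹ * (k : G)⁻¹ := by group
    rw [this, map_mul, ← smul_smul, Subgroup.conj_smul_eq_self_of_mem (K.inv_mem k.2)]
  change _ = ∑ h : H, (Nat.card (K ⊓ MulAut.conj (h : G) • L : Subgroup G) : ℚ) • f h
  rw [M.mackey hK hL s hs m]
  change _ • ∑ x ∈ s, f x = _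
  have h1 : ((Nat.card K : ℚ) * Nat.card L) • ∑ x ∈ s, f x =
      ∑ p ∈ s ×ˢ (Finset.univ : Finset (K × L)), f ((p.2.1 : G) * p.1 * p.2.2) := by
    rw [Finset.sum_product, Finset.smul_sum]
    refine Finset.sum_congr rfl fun x _ => ?_
    simp only [hf, Finset.sum_const, Finset.card_univ, Fintype.card_prod]
    rw [← Nat.cast_smul_eq_nsmul ℚ, Nat.cast_mul, Nat.card_eq_fintype_card,
      Nat.card_eq_fintype_card]
  have h2 : ∀ p ∈ s ×ˢ (Finset.univ : Finset (K × L)), (p.2.1 : G) * p.1 * p.2.2 ∈ H := by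
    intro p hp
    exact H.mul_mem (H.mul_mem (hK p.2.1.2) (hs.1 _ (Finset.mem_product.1 hp).1)) (hL p.2.2.2)
  -- Inserting an indicator of the product `k x l` lets the two sums be exchanged; the inner count
  -- is then the fibre size.
  have h3 : ∀ p ∈ s ×ˢ (Finset.univ : Finset (K × L)), f ((p.2.1 : G) * p.1 * p.2.2) =
      ∑ h : H, if (p.2.1 : G) * p.1 * p.2.2 = h then f h else 0 := by
    intro p hp
    rw [Finset.sum_eq_single ⟨_, h2 p hp⟩]
    · simp
    · rintro b - hb
      exact if_neg fun h => hb (Subtype.ext h.symm)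
    · simp
  rw [h1, Finset.sum_congr rfl h3, Finset.sum_comm]
  refine Finset.sum_congr rfl fun h _ => ?_
  rw [← Finset.sum_filter, Finset.sum_const, hs.card_fiber h.2, Nat.cast_smul_eq_nsmul]

/-! ### The operators `avg` -/

/-- The operator `I ∘ R` on `M(G/K)` through `K ∩ S`, weighted by `|K ∩ S| / |K|`. -/
noncomputable def avg (K S : Subgroup G) : Module.End ℚ (M.obj K) :=
  ((Nat.card (K ⊓ S : Subgroup G) : ℚ) / Nat.card K) •
    (M.ind (inf_le_left : K ⊓ S ≤ K) ∘ₗ M.res (inf_le_left : K ⊓ S ≤ K))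

/-- Values of `M` at equal but not syntactically equal subgroups are different types; this lemma
absorbs the transport by allowing any description `T` of the intersection. -/
theorem avg_apply {K S T : Subgroup G} (hT : T ≤ K) (e : K ⊓ S = T) (m : M.obj K) :
    M.avg K S m = ((Nat.card T : ℚ) / Nat.card K) • M.ind hT (M.res hT m) := by
  subst e
  rfl

theorem conj_avg {K K' : Subgroup G} (S : Subgroup G) (g : G) (e : K' = MulAut.conj g • K)
    (m : M.obj K) :
    M.conj g e (M.avg K S m) = M.avg K' (MulAut.conj g • S) (M.conj g e m) := by
  have e' : K' ⊓ MulAut.conj g • S = MulAut.conj g • (K ⊓ S) := by rw [Subgroup.smul_inf, e]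
  have c1 : Nat.card (K' ⊓ MulAut.conj g • S : Subgroup G) = Nat.card (K ⊓ S : Subgroup G) := by
    rw [e']
    exact (Nat.card_congr (Subgroup.equivSMul (MulAut.conj g) _).toEquiv).symm
  have c2 : Nat.card K' = Nat.card K := by
    rw [e]
    exact (Nat.card_congr (Subgroup.equivSMul (MulAut.conj g) _).toEquiv).symm
  rw [M.avg_apply inf_le_left rfl, M.avg_apply inf_le_left rfl, map_smul, c1, c2,
    ← M.ind_conj g inf_le_left inf_le_left e' e, M.res_conj g inf_le_left inf_le_left e' e]

theorem card_conj (g : G) (K : Subgroup G) :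
    Nat.card (MulAut.conj g • K : Subgroup G) = Nat.card K :=
  (Nat.card_congr (Subgroup.equivSMul (MulAut.conj g) K).toEquiv).symm

theorem card_ne_zero [Finite G] (K : Subgroup G) : (Nat.card K : ℚ) ≠ 0 :=
  Nat.cast_ne_zero.2 Nat.card_pos.ne'

/-- This is the averaged Mackey formula for `H ∩ S`, with the weights of `avg` cancelling its
cardinalities. Once summed over the stabilizers `S` of the points of a `G`-set, the conjugations by
`h` only permute the points. -/
theorem res_avg [Finite G] {K H : Subgroup G} [Fintype H] (hK : K ≤ H) (S : Subgroup G)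
    (m : M.obj H) :
    M.res hK (M.avg H S m) =
      (Nat.card H : ℚ)⁻¹ • ∑ h : H, M.avg K (MulAut.conj (h : G) • S) (M.res hK m) := by
  have h1 := M.mackey_sum hK (inf_le_left : H ⊓ S ≤ H) (M.res inf_le_left m)
  rw [M.avg_apply inf_le_left rfl, map_smul]
  have hK0 := card_ne_zero K
  have hH0 := card_ne_zero H
  -- As `h ∈ H` acts trivially on `M(G/H)`, the conjugated term is just `I ∘ R` through `K ∩ hSh⁻¹`;
  -- intersecting with `H` first changes nothing because `K ≤ H`.
  have h2 : ∀ h : H, (Nat.card (K ⊓ MulAut.conj (h : G) • (H ⊓ S) : Subgroup G) : ℚ) •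
        M.ind (K := K ⊓ MulAut.conj (h : G) • (H ⊓ S)) (H := K) inf_le_left
          (M.conj (h : G) (conj_inf (h : G) K (H ⊓ S))
            (M.res (K := (H ⊓ S) ⊓ MulAut.conj (h : G)⁻¹ • K) (H := H ⊓ S) inf_le_left
              (M.res inf_le_left m))) =
      (Nat.card K : ℚ) • M.avg K (MulAut.conj (h : G) • S) (M.res hK m) := by
    intro h
    have eH : H = MulAut.conj (h : G) • H := (Subgroup.conj_smul_eq_self_of_mem h.2).symm
    have e : K ⊓ MulAut.conj (h : G) • S = K ⊓ MulAut.conj (h : G) • (H ⊓ S) := by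
      rw [Subgroup.smul_inf, ← eH, ← inf_assoc, inf_eq_left.2 hK]
    rw [M.avg_apply inf_le_left e, smul_smul, mul_div_cancel₀ _ hK0, ← M.res_trans,
      ← M.res_conj (h : G) _ (inf_le_left.trans hK) _ eH, M.conj_self (h : G) h.2,
      ← M.res_trans]
  rw [Finset.sum_congr rfl fun h _ => h2 h, ← Finset.smul_sum] at h1
  rw [mul_smul] at h1
  have h3 := smul_right_injective _ hK0 h1
  rw [← h3, smul_smul, div_eq_inv_mul]

/-- The counterpart of `res_avg` for induction, the source of Frobenius reciprocity. Here each
Mackey term is moved back to `L` by conjugation, which is why `h⁻¹` appears. -/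
theorem avg_ind [Finite G] {L K : Subgroup G} [Fintype K] (hL : L ≤ K) (S : Subgroup G)
    (m : M.obj L) :
    M.avg K S (M.ind hL m) = (Nat.card K : ℚ)⁻¹ •
      M.ind hL (∑ h : K, M.avg L (MulAut.conj (h : G)⁻¹ • S) m) := by
  have hK0 := card_ne_zero K
  have hL0 := card_ne_zero L
  have h1 := M.mackey_sum (inf_le_left : K ⊓ S ≤ K) hL m
  have h2 := congrArg (M.ind (inf_le_left : K ⊓ S ≤ K)) h1
  rw [map_smul, map_sum] at h2
  -- Inducing on to `K` makes the conjugation by `h ∈ K` trivial, leaving `I ∘ R` through `L ∩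
  -- h⁻¹Sh`, a subgroup of the same order as the one in the Mackey term.
  have h3 : ∀ h : K, M.ind (inf_le_left : K ⊓ S ≤ K)
      ((Nat.card ((K ⊓ S) ⊓ MulAut.conj (h : G) • L : Subgroup G) : ℚ) •
        M.ind (K := (K ⊓ S) ⊓ MulAut.conj (h : G) • L) (H := K ⊓ S) inf_le_left
          (M.conj (h : G) (conj_inf (h : G) (K ⊓ S) L)
            (M.res (K := L ⊓ MulAut.conj (h : G)⁻¹ • (K ⊓ S)) (H := L) inf_le_left m))) =
      (Nat.card L : ℚ) • M.ind hL (M.avg L (MulAut.conj (h : G)⁻¹ • S) m) := by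
    intro h
    have eK : K = MulAut.conj (h : G) • K := (Subgroup.conj_smul_eq_self_of_mem h.2).symm
    have e : L ⊓ MulAut.conj (h : G)⁻¹ • S = L ⊓ MulAut.conj (h : G)⁻¹ • (K ⊓ S) := by
      rw [Subgroup.smul_inf, Subgroup.conj_smul_eq_self_of_mem (K.inv_mem h.2), ← inf_assoc,
        inf_eq_left.2 hL]
    have hc : Nat.card ((K ⊓ S) ⊓ MulAut.conj (h : G) • L : Subgroup G) =
        Nat.card (L ⊓ MulAut.conj (h : G)⁻¹ • (K ⊓ S) : Subgroup G) := by
      rw [conj_inf, card_conj]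
    rw [M.avg_apply inf_le_left e, map_smul, map_smul, smul_smul, mul_div_cancel₀ _ hL0, hc, ← M.ind_trans, ← M.ind_trans,
      M.ind_conj (h : G) (inf_le_left.trans hL) _ _ eK, M.conj_self (h : G) h.2]
  rw [Finset.sum_congr rfl fun h _ => h3 h, ← Finset.smul_sum, mul_comm, mul_smul] at h2
  have h4 := smul_right_injective _ hL0 h2
  change _ = ∑ h, _ at h4
  rw [M.avg_apply inf_le_left rfl, map_sum, ← h4, smul_smul, div_eq_inv_mul]

end MackeyFunctor

/-! ### Idempotents of the Burnside ring -/

namespace BurnsideRing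

variable {G : Type u} [Group G]

theorem span_range_mk (G : Type u) [Group G] :
    Submodule.span ℚ (Set.range (mk : FinGSet G → BurnsideRing G)) = ⊤ := by
  rw [eq_top_iff]
  rintro a -
  obtain ⟨a, rfl⟩ := Ideal.Quotient.mk_surjective a
  induction a using MonoidAlgebra.induction_on with
  | of c =>
    induction c using Quotient.inductionOn with
    | h X => exact Submodule.subset_span ⟨X, rfl⟩
  | add a b ha hb =>
    rw [map_add]
    exact Submodule.add_mem _ ha hb
  | smul r a ha => exact Submodule.smul_mem _ r ha

theorem linearMap_ext {N : Type*} [AddCommMonoid N] [Module ℚ N] {f g : BurnsideRing G →ₗ[ℚ] N}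
    (h : ∀ X, f (mk X) = g (mk X)) : f = g :=
  LinearMap.ext_on_range (span_range_mk G) h

theorem mk_mul_mk (X Y : FinGSet G) : mk X * mk Y = mk (FinGSet.prod X Y) := by
  rw [mk, mk, mk, ← map_mul, MonoidAlgebra.single_mul_single, mul_one]
  rfl

theorem mk_point : mk (FinGSet.point G) = 1 := rfl

/-- Restricting the action to `K` does not change the fixed points of a subgroup of `K`; linearity
extends this from `G`-sets to the whole ring. -/
theorem marks_res (K : Subgroup G) (S : Subgroup K) (a : BurnsideRing G) :
    marks K (res K a) (ConjSub.mk S) = marks G a (ConjSub.mk (S.map K.subtype)) := by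
  have h : (LinearMap.proj (ConjSub.mk S)).comp ((marks K).toLinearMap.comp (res K).toLinearMap) =
      (LinearMap.proj (ConjSub.mk (S.map K.subtype))).comp (marks G).toLinearMap := by
    refine linearMap_ext fun X => ?_
    change marks K (res K (mk X)) (ConjSub.mk S) = marks G (mk X) (ConjSub.mk (S.map K.subtype))
    rw [res_mk, marks_mk, marks_mk, Nat.cast_inj]
    refine Nat.card_congr (Equiv.subtypeEquivRight fun x => ?_)
    constructor
    · rintro h _ ⟨k, hk, rfl⟩
      exact h k hk
    · exact fun h k hk => h k ⟨k, hk, rfl⟩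
  exact LinearMap.congr_fun h a

open Classical in
theorem marks_idem [Finite G] (H : Subgroup G) : marks G (idem H) = Pi.single (ConjSub.mk H) 1 :=
  (tomDieck G).apply_symm_apply _

/-- Both sides have the same marks, and marks are injective. This is what makes the Burnside ring
act by scalars on an `e_H`-part. -/
theorem mul_idem [Finite G] (a : BurnsideRing G) (H : Subgroup G) :
    a * idem H = marks G a (ConjSub.mk H) • idem H := by
  classical
  refine marks_bijective.1 ?_
  rw [map_mul, map_smul, marks_idem]
  funext c
  by_cases h : c = ConjSub.mk H
  · subst h
    simp
  · simp [h]

theorem idem_mul_self [Finite G] (H : Subgroup G) : idem H * idem H = idem H := by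
  classical
  rw [mul_idem, marks_idem, Pi.single_eq_same, one_smul]

theorem idem_mul_of_ne [Finite G] {H K : Subgroup G} (h : ConjSub.mk H ≠ ConjSub.mk K) :
    idem H * idem K = 0 := by
  classical
  rw [mul_idem, marks_idem, Pi.single_eq_of_ne h.symm, zero_smul]

theorem sum_idem [Finite G] [Fintype (ConjSub G)] (rep : ConjSub G → Subgroup G)
    (hrep : ∀ c, ConjSub.mk (rep c) = c) : ∑ c, idem (rep c) = 1 := by
  classical
  refine marks_bijective.1 ?_
  rw [map_sum, map_one]
  funext d
  simp [marks_idem, hrep, Finset.sum_apply, Pi.single_apply]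

/-- The restriction of `e_H^G` to a subgroup that contains no conjugate of `H` is zero. -/
theorem res_idem_eq_zero [Finite G] {H K : Subgroup G} (h : ∀ g : G, ¬ MulAut.conj g • H ≤ K) :
    res K (idem H) = 0 := by
  classical
  refine marks_bijective.1 ?_
  rw [map_zero]
  funext c
  induction c using Quotient.inductionOn with
  | h S =>
    refine (marks_res K S _).trans ?_
    rw [marks_idem]
    refine Pi.single_eq_of_ne (fun e => ?_) _
    obtain ⟨g, hg⟩ := Quotient.exact e.symm
    exact h g (hg ▸ Subgroup.map_subtype_le S)

end BurnsideRing

/-! ### The Burnside ring acts by endomorphisms of a Mackey functor -/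

namespace MackeyFunctor

variable {G : Type u} [Group G] (M : MackeyFunctor.{u, v} G)

/-- The action of `A_ℚ(G)` on `M(G/K)` through the restriction `A_ℚ(G) → A_ℚ(K)`. -/
noncomputable def gact (K : Subgroup G) : BurnsideRing G →ₗ[ℚ] Module.End ℚ (M.obj K) :=
  M.burnsideAct K ∘ₗ (BurnsideRing.res K).toLinearMap

/-- The stabilizer in `K` of a point is `K` intersected with its stabilizer in `G`. Indexing by
points of the `G`-set, rather than by `K`-orbits, keeps one index set for all `K`. -/
theorem gact_mk (K : Subgroup G) (X : FinGSet G) [Fintype X.carrier] :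
    M.gact K (BurnsideRing.mk X) = ∑ x : X.carrier, M.avg K (MulAction.stabilizer G x) := by
  change M.burnsideAct K (BurnsideRing.res K (BurnsideRing.mk X)) = _
  rw [BurnsideRing.res_mk, burnsideAct_mk]
  let _ := Fintype.ofFinite (FinGSet.restrict K X).carrier
  refine @Fintype.sum_equiv (FinGSet.restrict K X).carrier X.carrier _ (Fintype.ofFinite _) _ _
    (Equiv.refl _) _ _ fun x => ?_
  ext m
  have e : K ⊓ MulAction.stabilizer G (show X.carrier from x) =
      (MulAction.stabilizer K x).map K.subtype := by
    ext g
    constructor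
    · rintro ⟨hg, h⟩
      exact ⟨⟨g, hg⟩, h, rfl⟩
    · rintro ⟨k, hk, rfl⟩
      exact ⟨k.2, hk⟩
  refine Eq.trans ?_ (M.avg_apply (Subgroup.map_subtype_le _) e m).symm
  rw [show Nat.card ((MulAction.stabilizer K x).map K.subtype) =
    Nat.card (MulAction.stabilizer K x) from
    (Nat.card_congr ((MulAction.stabilizer K x).equivMapOfInjective _
      K.subtype_injective).toEquiv).symm]
  rfl

theorem gact_mk_apply (K : Subgroup G) (X : FinGSet G) [Fintype X.carrier] (m : M.obj K) :
    M.gact K (BurnsideRing.mk X) m = ∑ x : X.carrier, M.avg K (MulAction.stabilizer G x) m := by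
  rw [gact_mk, LinearMap.sum_apply]

/-- Translation by `g` permutes the points of `X` and conjugates their stabilizers. -/
theorem sum_avg_smul (K : Subgroup G) (X : FinGSet G) [Fintype X.carrier] (g : G) (m : M.obj K) :
    ∑ x : X.carrier, M.avg K (MulAut.conj g • MulAction.stabilizer G x) m =
      M.gact K (BurnsideRing.mk X) m := by
  rw [gact_mk_apply]
  refine Fintype.sum_equiv (MulAction.toPerm g) _ _ fun x => ?_
  rw [MulAction.toPerm_apply, MulAction.stabilizer_smul_eq_stabilizer_map_conj]
  rfl

/-- By `res_avg` the left side is an average over `H` of sums over points with conjugated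
stabilizers, and by `sum_avg_smul` all these sums are equal to the right side. -/
theorem res_gact [Finite G] {K H : Subgroup G} (h : K ≤ H) (a : BurnsideRing G) (m : M.obj H) :
    M.res h (M.gact H a m) = M.gact K a (M.res h m) := by
  revert a
  -- Both sides are linear in `a`, so it is enough to compare them on classes of finite `G`-sets.
  -- The same reduction recurs below.
  refine LinearMap.congr_fun (f := M.res h ∘ₗ (M.gact H).flip m)
    (g := (M.gact K).flip (M.res h m)) (BurnsideRing.linearMap_ext fun X => ?_)
  change M.res h (M.gact H (BurnsideRing.mk X) m) = M.gact K (BurnsideRing.mk X) (M.res h m)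
  have := Fintype.ofFinite X.carrier
  have := Fintype.ofFinite H
  rw [gact_mk_apply, map_sum]
  simp only [res_avg]
  rw [← Finset.smul_sum, Finset.sum_comm]
  simp only [sum_avg_smul]
  rw [Finset.sum_const, Finset.card_univ, ← Nat.card_eq_fintype_card, ← Nat.cast_smul_eq_nsmul ℚ,
    smul_smul, inv_mul_cancel₀ (card_ne_zero H), one_smul]

theorem ind_gact [Finite G] {K H : Subgroup G} (h : K ≤ H) (a : BurnsideRing G) (m : M.obj K) :
    M.ind h (M.gact K a m) = M.gact H a (M.ind h m) := by
  revert a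
  refine LinearMap.congr_fun (f := M.ind h ∘ₗ (M.gact K).flip m)
    (g := (M.gact H).flip (M.ind h m)) (BurnsideRing.linearMap_ext fun X => ?_)
  change M.ind h (M.gact K (BurnsideRing.mk X) m) = M.gact H (BurnsideRing.mk X) (M.ind h m)
  have := Fintype.ofFinite X.carrier
  have := Fintype.ofFinite H
  rw [M.gact_mk_apply H]
  simp only [avg_ind]
  rw [← Finset.smul_sum, ← map_sum, Finset.sum_comm]
  simp only [sum_avg_smul]
  rw [Finset.sum_const, Finset.card_univ, ← Nat.card_eq_fintype_card, ← Nat.cast_smul_eq_nsmul ℚ,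
    map_smul, smul_smul, inv_mul_cancel₀ (card_ne_zero H), one_smul]

theorem conj_gact [Finite G] {K K' : Subgroup G} (g : G) (e : K' = MulAut.conj g • K)
    (a : BurnsideRing G) (m : M.obj K) :
    M.conj g e (M.gact K a m) = M.gact K' a (M.conj g e m) := by
  revert a
  refine LinearMap.congr_fun (f := M.conj g e ∘ₗ (M.gact K).flip m)
    (g := (M.gact K').flip (M.conj g e m)) (BurnsideRing.linearMap_ext fun X => ?_)
  change M.conj g e (M.gact K (BurnsideRing.mk X) m) =
    M.gact K' (BurnsideRing.mk X) (M.conj g e m)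
  have := Fintype.ofFinite X.carrier
  rw [gact_mk_apply, map_sum, ← sum_avg_smul M K' X g]
  simp only [conj_avg]

theorem avg_inf [Finite G] (K S T : Subgroup G) (m : M.obj K) :
    M.avg K (S ⊓ T) m = ((Nat.card (K ⊓ S : Subgroup G) : ℚ) / Nat.card K) •
      M.ind inf_le_left (M.avg (K ⊓ S) T (M.res inf_le_left m)) := by
  rw [M.avg_apply (T := K ⊓ S ⊓ T) (inf_le_left.trans inf_le_left) (inf_assoc _ _ _).symm,
    M.avg_apply inf_le_left rfl, map_smul, smul_smul, ← M.res_trans, ← M.ind_trans,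
    mul_comm, div_mul_div_cancel₀ (card_ne_zero _)]

/-- The stabilizer of a pair is the intersection of the two stabilizers, so by `avg_inf` the term of
`x` applies the class of `Y` between restriction and induction. Since `gact` commutes with
restriction, that class can be pulled out to the right. -/
theorem gact_mk_mul [Finite G] (K : Subgroup G) (X : FinGSet G) (b : BurnsideRing G)
    (m : M.obj K) :
    M.gact K (BurnsideRing.mk X * b) m = M.gact K (BurnsideRing.mk X) (M.gact K b m) := by
  revert b
  refine LinearMap.congr_fun (f := (M.gact K).flip m ∘ₗ LinearMap.mulLeft ℚ (BurnsideRing.mk X))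
    (g := M.gact K (BurnsideRing.mk X) ∘ₗ (M.gact K).flip m)
    (BurnsideRing.linearMap_ext fun Y => ?_)
  change M.gact K (BurnsideRing.mk X * BurnsideRing.mk Y) m =
    M.gact K (BurnsideRing.mk X) (M.gact K (BurnsideRing.mk Y) m)
  let _ := Fintype.ofFinite X.carrier
  let _ := Fintype.ofFinite Y.carrier
  let _ : Fintype (FinGSet.prod X Y).carrier := inferInstanceAs (Fintype (X.carrier × Y.carrier))
  rw [BurnsideRing.mk_mul_mk, gact_mk_apply, M.gact_mk_apply K X]
  refine (Fintype.sum_prod_type _).trans (Finset.sum_congr rfl fun x _ => ?_)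
  have e : ∀ y : Y.carrier, MulAction.stabilizer G (show (FinGSet.prod X Y).carrier from (x, y)) =
      MulAction.stabilizer G x ⊓ MulAction.stabilizer G y := by
    intro y
    ext g
    exact Prod.ext_iff
  rw [M.avg_apply inf_le_left rfl, res_gact, gact_mk_apply, map_sum, Finset.smul_sum]
  refine Finset.sum_congr rfl fun y _ => ?_
  rw [← avg_inf]
  exact congrArg (fun S => M.avg K S m) (e y)

theorem gact_mul [Finite G] (K : Subgroup G) (a b : BurnsideRing G) (m : M.obj K) :
    M.gact K (a * b) m = M.gact K a (M.gact K b m) := by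
  revert a
  exact LinearMap.congr_fun (f := (M.gact K).flip m ∘ₗ LinearMap.mulRight ℚ b)
    (g := (M.gact K).flip (M.gact K b m))
    (BurnsideRing.linearMap_ext fun X => M.gact_mk_mul K X b m)

theorem gact_one [Finite G] (K : Subgroup G) (m : M.obj K) : M.gact K 1 m = m := by
  let _ : Fintype (FinGSet.point G).carrier := inferInstanceAs (Fintype PUnit)
  rw [← BurnsideRing.mk_point, gact_mk_apply]
  refine (Fintype.sum_unique (ι := PUnit) _).trans ?_
  rw [M.avg_apply le_rfl (inf_eq_left.2 fun g _ => rfl), div_self (card_ne_zero K), one_smul,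
    M.ind_self, M.res_self]

namespace Hom

variable {M} {N : MackeyFunctor.{u, v} G}

theorem app_gact [Finite G] (f : Hom M N) (K : Subgroup G) (a : BurnsideRing G) (m : M.obj K) :
    f.app K (M.gact K a m) = N.gact K a (f.app K m) := by
  revert a
  refine LinearMap.congr_fun (f := f.app K ∘ₗ (M.gact K).flip m)
    (g := (N.gact K).flip (f.app K m)) (BurnsideRing.linearMap_ext fun X => ?_)
  change f.app K (M.gact K (BurnsideRing.mk X) m) = N.gact K (BurnsideRing.mk X) (f.app K m)
  have := Fintype.ofFinite X.carrier
  rw [gact_mk_apply, gact_mk_apply, map_sum]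
  refine Finset.sum_congr rfl fun x _ => ?_
  rw [M.avg_apply inf_le_left rfl, N.avg_apply inf_le_left rfl, map_smul, f.app_ind, f.app_res]

end Hom

/-- An idempotent operator is surjective exactly when it is the identity. -/
theorem isIdemPart_iff [Finite G] {H : Subgroup G} :
    IsIdemPart H M ↔ ∀ (K : Subgroup G) (m : M.obj K), M.gact K (BurnsideRing.idem H) m = m := by
  refine forall_congr' fun K => ?_
  change LinearMap.range (M.gact K (BurnsideRing.idem H)) = ⊤ ↔ _
  rw [LinearMap.range_eq_top]
  constructor
  · intro h m
    obtain ⟨m, rfl⟩ := h m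
    rw [← gact_mul, BurnsideRing.idem_mul_self]
  · exact fun h m => ⟨m, h m⟩

end MackeyFunctor

/-! ### Mackey functors with `M = e_H M` -/

namespace MackeyFunctor

variable {G : Type u} [Group G] [Finite G]

section IdemPart

variable {M : MackeyFunctor.{u, v} G} {H : Subgroup G}

theorem IsIdemPart.gact_eq_smul (hM : IsIdemPart H M) (K : Subgroup G) (a : BurnsideRing G)
    (m : M.obj K) : M.gact K a m = BurnsideRing.marks G a (ConjSub.mk H) • m := by
  rw [M.isIdemPart_iff] at hM
  conv_lhs => rw [← hM K m]
  rw [← gact_mul, BurnsideRing.mul_idem, map_smul, LinearMap.smul_apply, hM]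

theorem IsIdemPart.eq_zero (hM : IsIdemPart H M) {K : Subgroup G}
    (h : ∀ g : G, ¬ MulAut.conj g • H ≤ K) (m : M.obj K) : m = 0 := by
  rw [M.isIdemPart_iff] at hM
  rw [← hM K m]
  change M.burnsideAct K (BurnsideRing.res K (BurnsideRing.idem H)) m = 0
  rw [BurnsideRing.res_idem_eq_zero h, map_zero, LinearMap.zero_apply]

theorem conj_smul_eq_of_le {H : Subgroup G} {g g' : G}
    (h : MulAut.conj g' • H ≤ MulAut.conj g • H) : MulAut.conj g' • H = MulAut.conj g • H :=
  Subgroup.eq_of_le_of_card_ge h (by rw [card_conj, card_conj])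

/-- Otherwise `K ∩ gHg⁻¹` is a proper subgroup of `gHg⁻¹`, so by order it contains no conjugate of
`H` and the operator factors through a zero module. -/
theorem IsIdemPart.avg_conj_eq_zero (hM : IsIdemPart H M) {K : Subgroup G} {g : G}
    (h : ¬ MulAut.conj g • H ≤ K) (m : M.obj K) : M.avg K (MulAut.conj g • H) m = 0 := by
  rw [M.avg_apply inf_le_left rfl, hM.eq_zero (fun g' hg' => h ?_) (M.res inf_le_left m),
    map_zero, smul_zero]
  rw [← conj_smul_eq_of_le (hg'.trans inf_le_right)]
  exact hg'.trans inf_le_left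

theorem stabilizer_mk {G : Type u} [Group G] {H : Subgroup G} (g : G) : MulAction.stabilizer G (g : G ⧸ H) = MulAut.conj g • H := by
  ext a
  rw [MulAction.mem_stabilizer_iff, mem_conj_iff, ← H.inv_mem_iff,
    MulAction.Quotient.smul_mk, QuotientGroup.eq]
  simp [mul_assoc]

/-- On `e_H M`, the class `[G/H]` acts as multiplication by `|(G/H)^H|`. -/
theorem IsIdemPart.sum_avg (hM : IsIdemPart H M) [Fintype (G ⧸ H)] {K : Subgroup G}
    (m : M.obj K) : ∑ x : G ⧸ H, M.avg K (MulAction.stabilizer G x) m =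
      (FinGSet.fixedCard H (FinGSet.orbit H) : ℚ) • m := by
  let _ : Fintype (FinGSet.orbit H).carrier := inferInstanceAs (Fintype (G ⧸ H))
  rw [← BurnsideRing.marks_mk, ← hM.gact_eq_smul, gact_mk_apply]
  rfl

/-- A nonzero multiple of `m` is the value of `[G/H]` on `m`, hence a combination of the elements `I
R m` through conjugates of `H` contained in `K`. With `P = ⊥` this gives injectivity of the unit,
with `P` its range surjectivity. -/
theorem IsIdemPart.mem_of_avg (hM : IsIdemPart H M) {K : Subgroup G} (m : M.obj K)
    (P : Submodule ℚ (M.obj K))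
    (h : ∀ (g : G) (hg : MulAut.conj g • H ≤ K), M.ind hg (M.res hg m) ∈ P) : m ∈ P := by
  have := Fintype.ofFinite (G ⧸ H)
  have h0 : (FinGSet.fixedCard H (FinGSet.orbit H) : ℚ) ≠ 0 :=
    Nat.cast_ne_zero.2 (FinGSet.fixedCard_self_ne_zero H)
  rw [← P.smul_mem_iff h0, ← hM.sum_avg]
  refine P.sum_mem fun x _ => ?_
  induction x using QuotientGroup.induction_on with
  | H g =>
    rw [stabilizer_mk]
    by_cases hg : MulAut.conj g • H ≤ K
    · rw [M.avg_apply hg (inf_eq_right.2 hg)]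
      exact P.smul_mem _ (h g hg)
    · rw [hM.avg_conj_eq_zero hg]
      exact P.zero_mem

/-- On `e_H M`, elements are detected by their restrictions to the conjugates of `H`. -/
theorem IsIdemPart.eq_zero_of_res (hM : IsIdemPart H M) {K : Subgroup G} (m : M.obj K)
    (h : ∀ (g : G) (hg : MulAut.conj g • H ≤ K), M.res hg m = 0) : m = 0 := by
  rw [← Submodule.mem_bot ℚ]
  refine hM.mem_of_avg m ⊥ fun g hg => ?_
  rw [h g hg, map_zero]
  exact Submodule.zero_mem _

end IdemPart

/-! ### `F_H V` lies in the `e_H`-part -/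

section Free

variable {H : Subgroup G}

open Classical in
/-- Summation over a fibre of `(G/L)^H → (G/K)^H` through the elements of `K`. -/
theorem FixPts.sum_fiber {N : Type*} [AddCommGroup N] [Module ℚ N] {L K : Subgroup G} [Fintype K]
    (hLK : L ≤ K) (g : G) (hg : ∀ h ∈ H, h • (g : G ⧸ K) = g) (φ : FixPts H L → N) (ψ : K → N)
    (h1 : ∀ (k : K) (hk : ∀ h ∈ H, h • ((g * k : G) : G ⧸ L) = (g * k : G)),
      ψ k = φ (FixPts.mk (g * k) hk))
    (h0 : ∀ k : K, (¬ ∀ h ∈ H, h • ((g * k : G) : G ⧸ L) = (g * k : G)) → ψ k = 0) :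
    ∑ k, ψ k = (Nat.card L : ℚ) • ∑ τ with FixPts.proj hLK τ = FixPts.mk g hg, φ τ := by
  -- Each `k` contributes at the single point `gkL` if it is `H`-fixed and nowhere otherwise;
  -- exchanging sums leaves the number of `k` over a given point.
  have h2 : ∀ k : K, ψ k = ∑ τ : FixPts H L with FixPts.proj hLK τ = FixPts.mk g hg,
      if τ.1 = ((g * k : G) : G ⧸ L) then φ τ else 0 := by
    intro k
    by_cases hk : ∀ h ∈ H, h • ((g * k : G) : G ⧸ L) = (g * k : G)
    · rw [Finset.sum_eq_single (FixPts.mk (g * k) hk), h1 k hk]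
      · exact (if_pos rfl).symm
      · exact fun τ _ hτ => if_neg fun e => hτ (Subtype.ext e)
      · intro hn
        refine (hn ?_).elim
        rw [Finset.mem_filter, FixPts.eq_iff (g * k) g rfl rfl]
        simp
    · rw [h0 k hk]
      symm
      refine Finset.sum_eq_zero fun τ _ => if_neg fun e => hk ?_
      rw [← e]
      exact τ.2
  simp only [h2]
  rw [Finset.sum_comm, Finset.smul_sum]
  refine Finset.sum_congr rfl fun τ hτ => ?_
  rw [← Finset.sum_filter, Finset.sum_const, ← Nat.cast_smul_eq_nsmul ℚ]
  congr 2
  obtain ⟨t, ht, rfl⟩ := FixPts.exists_mk τ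
  rw [Finset.mem_filter, FixPts.eq_iff t g rfl rfl] at hτ
  have htK : g⁻¹ * t ∈ K := by simpa using K.inv_mem hτ.2
  have := Fintype.ofFinite L
  rw [Nat.card_eq_fintype_card, ← Finset.card_univ]
  symm
  -- The elements `k` with `gkL = tL` form the coset `g⁻¹ t L`, whence the factor `|L|`.
  refine Finset.card_bij (fun l _ => ⟨g⁻¹ * t * l, K.mul_mem htK (hLK l.2)⟩) ?_ ?_ ?_
  · intro l _
    rw [Finset.mem_filter]
    refine ⟨Finset.mem_univ _, ?_⟩
    change (t : G ⧸ L) = _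
    rw [QuotientGroup.eq]
    simp [mul_assoc]
  · intro l _ l' _ e
    exact Subtype.ext (mul_left_cancel (congrArg Subtype.val e))
  · rintro ⟨k, hk⟩ hm
    have e : (t : G ⧸ L) = ((g * k : G) : G ⧸ L) := (Finset.mem_filter.1 hm).2
    rw [QuotientGroup.eq] at e
    exact ⟨⟨t⁻¹ * (g * k), e⟩, Finset.mem_univ _, Subtype.ext (by simp [mul_assoc])⟩

/-- The component at `σ` of an element of `F_H V (G/K)`. -/
noncomputable def freeEval (V : Rep.{v} ℚ (WeylGroup H)) {K : Subgroup G} (σ : FixPts H K) :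
    (free V).obj K →ₗ[ℚ] V :=
  LinearMap.proj σ ∘ₗ (freeObj V K).subtype

theorem free_ext (V : Rep.{v} ℚ (WeylGroup H)) {K : Subgroup G} {y z : (free V).obj K}
    (h : ∀ (g : G) (hg : ∀ h ∈ H, h • (g : G ⧸ K) = g),
      freeEval V (FixPts.mk g hg) y = freeEval V (FixPts.mk g hg) z) : y = z := by
  apply Subtype.ext
  funext σ
  obtain ⟨g, hg, rfl⟩ := FixPts.exists_mk σ
  exact h g hg

open Classical in
theorem freeEval_ind (V : Rep.{v} ℚ (WeylGroup H)) {K A : Subgroup G} (hKA : K ≤ A)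
    (y : (free V).obj K) (τ : FixPts H A) :
    freeEval V τ ((free V).ind hKA y) = ∑ σ with FixPts.proj hKA σ = τ, freeEval V σ y := rfl

theorem freeEval_res (V : Rep.{v} ℚ (WeylGroup H)) {K A : Subgroup G} (hKA : K ≤ A)
    (y : (free V).obj A) (σ : FixPts H K) :
    freeEval V σ ((free V).res hKA y) = freeEval V (FixPts.proj hKA σ) y := rfl

theorem freeEval_conj (V : Rep.{v} ℚ (WeylGroup H)) (g : G) {K K' : Subgroup G}
    (e : K' = MulAut.conj g • K) (y : (free V).obj K) (σ : FixPts H K') :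
    freeEval V σ ((free V).conj g e y) = freeEval V (FixPts.rmul g e σ) y := rfl

open Classical in
-- Restricting and then inducing multiplies a component by the size of its fibre in `(G/(K ∩ S))^H`.
-- As `gK` is already `H`-fixed, the point `gk(K ∩ S)` is fixed exactly when `H` lies in the
-- conjugate of `S` by `gk`.
theorem freeEval_avg (V : Rep.{v} ℚ (WeylGroup H)) {K : Subgroup G} [Fintype K] (S : Subgroup G)
    (y : (free V).obj K) (g : G) (hg : ∀ h ∈ H, h • (g : G ⧸ K) = g) :
    freeEval V (FixPts.mk g hg) ((free V).avg K S y) = (Nat.card K : ℚ)⁻¹ • ∑ k : K,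
      if H ≤ MulAut.conj (g * k : G) • S then freeEval V (FixPts.mk g hg) y else 0 := by
  rw [(free V).avg_apply inf_le_left rfl, map_smul, freeEval_ind,
    FixPts.sum_fiber (inf_le_left : K ⊓ S ≤ K) g hg
      (fun _ => freeEval V (FixPts.mk g hg) y), smul_smul, div_eq_inv_mul]
  · refine congrArg _ (Finset.sum_congr rfl fun τ hτ => ?_)
    rw [freeEval_res, (Finset.mem_filter.1 hτ).2]
  · intro k hk
    rw [FinGSet.fixed_mk_iff] at hk
    refine if_pos (hk.trans ?_)
    rw [Subgroup.smul_inf]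
    exact inf_le_right
  · intro k hk
    refine if_neg fun h => hk ?_
    rw [FinGSet.fixed_mk_iff] at hg ⊢
    rw [Subgroup.smul_inf]
    refine le_inf ?_ h
    rwa [map_mul, ← smul_smul, Subgroup.conj_smul_eq_self_of_mem k.2]

theorem le_conj_stabilizer_iff {G : Type u} [Group G] {H : Subgroup G} (X : FinGSet G) (g : G) (x : X.carrier) :
    H ≤ MulAut.conj g • MulAction.stabilizer G x ↔ ∀ h ∈ H, h • g • x = g • x := by
  refine forall₂_congr fun h _ => ?_
  rw [mem_conj_iff, MulAction.mem_stabilizer_iff, mul_assoc, mul_smul, mul_smul, inv_smul_eq_iff]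

/-- The Burnside ring acts on `F_H V` through the mark at `H`. -/
theorem free_gact (V : Rep.{v} ℚ (WeylGroup H)) (K : Subgroup G) (a : BurnsideRing G)
    (y : (free V).obj K) :
    (free V).gact K a y = BurnsideRing.marks G a (ConjSub.mk H) • y := by
  classical
  revert a
  refine LinearMap.congr_fun (f := ((free V).gact K).flip y)
    (g := ((LinearMap.proj (ConjSub.mk H)) ∘ₗ (BurnsideRing.marks G).toLinearMap).smulRight y)
    (BurnsideRing.linearMap_ext fun X => ?_)
  change (free V).gact K (BurnsideRing.mk X) y =
    BurnsideRing.marks G (BurnsideRing.mk X) (ConjSub.mk H) • y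
  have := Fintype.ofFinite X.carrier
  have := Fintype.ofFinite K
  rw [BurnsideRing.marks_mk, gact_mk_apply]
  refine free_ext V fun g hg => ?_
  rw [map_sum, map_smul]
  simp only [freeEval_avg]
  rw [← Finset.smul_sum, Finset.sum_comm]
  -- For fixed `k` the bijection `x ↦ gkx` turns the condition into `x ∈ X^H`, so the inner sum does
  -- not depend on `k` and the average over `K` is harmless.
  have h : ∀ k : K, (∑ x : X.carrier,
      if H ≤ MulAut.conj (g * k : G) • MulAction.stabilizer G x then freeEval V (FixPts.mk g hg) y else 0) =
      (FinGSet.fixedCard H X : ℚ) • freeEval V (FixPts.mk g hg) y := by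
    intro k
    simp only [le_conj_stabilizer_iff]
    refine (Fintype.sum_equiv (MulAction.toPerm (g * k : G)) _
      (fun x : X.carrier => if ∀ h ∈ H, h • x = x then freeEval V (FixPts.mk g hg) y else 0)
      fun x => rfl).trans ?_
    rw [← Finset.sum_filter, Finset.sum_const, ← Nat.cast_smul_eq_nsmul ℚ,
      FinGSet.fixedCard, Nat.card_eq_fintype_card, Fintype.card_subtype]
  rw [Finset.sum_congr rfl fun k _ => h k, Finset.sum_const, ← Nat.cast_smul_eq_nsmul ℚ,
    Finset.card_univ, ← Nat.card_eq_fintype_card, smul_smul, inv_mul_cancel₀ (card_ne_zero K),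
    one_smul]

theorem isIdemPart_free (V : Rep.{v} ℚ (WeylGroup H)) : IsIdemPart H (free V) := by
  classical
  rw [isIdemPart_iff]
  intro K m
  rw [free_gact, BurnsideRing.marks_idem, Pi.single_eq_same, one_smul]

end Free

end MackeyFunctor

/-! ### Pullback along `G/H → G/K` -/

namespace MackeyFunctor

section ResConj

variable {G : Type u} [Group G] (M : MackeyFunctor.{u, v} G)

/-- The map `M(G/K) → M(G/H)` induced by the `G`-map `G/H → G/K`, `x H ↦ x g K`. -/
def resConj (g : G) {H K : Subgroup G} (h : H ≤ MulAut.conj g • K) : M.obj K →ₗ[ℚ] M.obj H :=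
  M.res h ∘ₗ M.conj g rfl

/-- Together with `conj_res_eq_resConj` this allows conjugating before or after restricting, with
any name for the conjugate subgroup. -/
theorem res_conj_eq_resConj (g : G) {H K K' : Subgroup G} (e : K' = MulAut.conj g • K)
    (h' : H ≤ K') (h : H ≤ MulAut.conj g • K) (m : M.obj K) :
    M.res h' (M.conj g e m) = M.resConj g h m := by
  subst e
  rfl

theorem conj_res_eq_resConj (g : G) {H H' K : Subgroup G} (e : H = MulAut.conj g • H')
    (h' : H' ≤ K) (h : H ≤ MulAut.conj g • K) (m : M.obj K) :
    M.conj g e (M.res h' m) = M.resConj g h m :=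
  (M.res_conj g h' h e rfl m).symm

/-- The pullback depends only on the coset `gK`, because elements of `K` act trivially on `M(G/K)`.
It is therefore indexed by the points of `(G/K)^H`. -/
theorem resConj_mul {g g' : G} {H K : Subgroup G} (h : H ≤ MulAut.conj g • K)
    (h' : H ≤ MulAut.conj g' • K) (hk : g⁻¹ * g' ∈ K) (m : M.obj K) :
    M.resConj g h m = M.resConj g' h' m := by
  obtain ⟨k, rfl⟩ : ∃ k, g' = g * k := ⟨g⁻¹ * g', by simp⟩
  have eK : K = MulAut.conj k • K :=
    (Subgroup.conj_smul_eq_self_of_mem (by simpa using hk)).symm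
  have e : MulAut.conj (g * k) • K = MulAut.conj g • K := by rw [map_mul, ← smul_smul, ← eK]
  have h1 := M.conj_mul g k eK rfl e.symm m
  rw [M.conj_self k (by simpa using hk)] at h1
  rw [← M.res_conj_eq_resConj (g * k) e.symm h h', h1]
  rfl

theorem resConj_of_mem {g : G} {H K : Subgroup G} (hHK : H ≤ K) (h : H ≤ MulAut.conj g • K)
    (hg : g ∈ K) (m : M.obj K) : M.resConj g h m = M.res hHK m := by
  rw [← M.res_conj_eq_resConj g (Subgroup.conj_smul_eq_self_of_mem hg).symm hHK h,
    M.conj_self g hg]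

/-- For `n` in the normalizer of `H` this is the equivariance that places the family of pullbacks in
`F_H`. -/
theorem conj_resConj (n g : G) {H H' K : Subgroup G} (e : H' = MulAut.conj n • H)
    (h : H ≤ MulAut.conj g • K) (h' : H' ≤ MulAut.conj (n * g) • K) (m : M.obj K) :
    M.conj n e (M.resConj g h m) = M.resConj (n * g) h' m := by
  have e' : MulAut.conj (n * g) • K = MulAut.conj n • MulAut.conj g • K := by
    rw [smul_smul, ← map_mul]
  change M.conj n e (M.res h (M.conj g rfl m)) = M.res h' (M.conj (n * g) rfl m)
  rw [← M.res_conj n h h' e e', ← M.conj_mul n g rfl e' rfl]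

theorem resConj_res (g : G) {H L K : Subgroup G} (hLK : L ≤ K) (h : H ≤ MulAut.conj g • L)
    (h' : H ≤ MulAut.conj g • K) (m : M.obj K) :
    M.resConj g h (M.res hLK m) = M.resConj g h' m := by
  change M.res h (M.conj g rfl (M.res hLK m)) = M.res h' (M.conj g rfl m)
  have hg : MulAut.conj g • L ≤ MulAut.conj g • K := by simpa using hLK
  rw [← M.res_conj g hLK hg rfl rfl, ← M.res_trans]

theorem resConj_conj (x g : G) {H K K' : Subgroup G} (e : K' = MulAut.conj g • K)
    (h : H ≤ MulAut.conj x • K') (h' : H ≤ MulAut.conj (x * g) • K) (m : M.obj K) :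
    M.resConj x h (M.conj g e m) = M.resConj (x * g) h' m := by
  have e' : MulAut.conj (x * g) • K = MulAut.conj x • K' := by
    rw [e, smul_smul, ← map_mul]
  rw [← M.res_conj_eq_resConj (x * g) e'.symm h h', M.conj_mul x g e rfl e'.symm]
  rfl

theorem Hom.app_resConj {M N : MackeyFunctor.{u, v} G} (f : Hom M N) (g : G) {H K : Subgroup G}
    (h : H ≤ MulAut.conj g • K) (m : M.obj K) :
    f.app H (M.resConj g h m) = N.resConj g h (f.app K m) := by
  change f.app H (M.res h (M.conj g rfl m)) = N.res h (N.conj g rfl (f.app K m))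
  rw [f.app_res, f.app_conj]

end ResConj

/-! ### The unit `M ⟶ F_H(M(G/H))` and its bijectivity -/

section Unit

theorem conj_inv_smul_le_iff {G : Type u} [Group G] {g : G} {H K : Subgroup G} :
    MulAut.conj g⁻¹ • H ≤ K ↔ H ≤ MulAut.conj g • K := by
  rw [map_inv, Subgroup.pointwise_smul_subset_iff, inv_inv]

variable {G : Type u} [Group G] [Finite G]

open Classical in
-- In the Mackey formula for `g⁻¹Hg` and `L` inside `K`, a term with `g⁻¹Hg ≤ kLk⁻¹` involves no
-- induction and is a pullback along `gkL`. Every other term passes through a proper subgroup of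
-- `g⁻¹Hg`, where `M` vanishes.
theorem IsIdemPart.resConj_ind {M : MackeyFunctor.{u, v} G} {H : Subgroup G} (hM : IsIdemPart H M)
    {L K : Subgroup G} (hLK : L ≤ K) (g : G) (hg : ∀ h ∈ H, h • (g : G ⧸ K) = g)
    (φ : FixPts H L → M.obj H) (m : M.obj L)
    (hφ : ∀ (x : G) (hx : ∀ h ∈ H, h • (x : G ⧸ L) = x),
      φ (FixPts.mk x hx) = M.resConj x ((FinGSet.fixed_mk_iff H L x).1 hx) m) :
    M.resConj g ((FinGSet.fixed_mk_iff H K g).1 hg) (M.ind hLK m) =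
      ∑ τ with FixPts.proj hLK τ = FixPts.mk g hg, φ τ := by
  have := Fintype.ofFinite K
  have hgK := (FinGSet.fixed_mk_iff H K g).1 hg
  have eH : H = MulAut.conj g • MulAut.conj g⁻¹ • H := by
    rw [smul_smul, ← map_mul, mul_inv_cancel, map_one, one_smul]
  have hH' : MulAut.conj g⁻¹ • H ≤ K := conj_inv_smul_le_iff.2 hgK
  have hcard : (Nat.card (MulAut.conj g⁻¹ • H : Subgroup G) : ℚ) ≠ 0 := card_ne_zero _
  have hL0 : (Nat.card L : ℚ) ≠ 0 := card_ne_zero _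
  rw [← M.conj_res_eq_resConj g eH hH' hgK]
  have h1 := congrArg (M.conj g eH) (M.mackey_sum hH' hLK m)
  rw [map_smul, map_sum, mul_smul] at h1
  -- Extension by zero over the non-fixed cosets `gkL`, in the shape required by `FixPts.sum_fiber`.
  let ψ : K → M.obj H := fun k => if hk : H ≤ MulAut.conj (g * k : G) • L then
    M.resConj (g * k) hk m else 0
  -- The subgroup `B` is kept as a variable with an equation, so that it can be replaced by `g⁻¹Hg`
  -- when the two coincide.
  have key : ∀ (k : K) {A B : Subgroup G} (hA : A ≤ L) (hB : B ≤ MulAut.conj g⁻¹ • H)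
      (e : B = MulAut.conj (k : G) • A), B = MulAut.conj g⁻¹ • H ⊓ MulAut.conj (k : G) • L →
      M.conj g eH ((Nat.card B : ℚ) • M.ind hB (M.conj (k : G) e (M.res hA m))) =
        (Nat.card (MulAut.conj g⁻¹ • H : Subgroup G) : ℚ) • ψ k := by
    intro k A B hA hB e eB
    by_cases hk : H ≤ MulAut.conj (g * k : G) • L
    · have hk' : MulAut.conj g⁻¹ • H ≤ MulAut.conj (k : G) • L := by
        rwa [conj_inv_smul_le_iff, smul_smul, ← map_mul]
      rw [inf_eq_left.2 hk'] at eB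
      subst eB
      rw [M.ind_self, map_smul, M.conj_res_eq_resConj (k : G) e hA hk',
        M.conj_resConj g k eH hk' hk]
      have : ψ k = M.resConj (g * k) hk m := dif_pos hk
      rw [this]
    · have : ψ k = 0 := dif_neg hk
      rw [this, smul_zero, hM.eq_zero (fun x hx => hk ?_) (M.conj (k : G) e (M.res hA m)),
        map_zero, smul_zero, map_zero]
      have h2 := conj_smul_eq_of_le (hx.trans hB)
      have h3 := hx.trans eB.le |>.trans inf_le_right
      rwa [h2, conj_inv_smul_le_iff, smul_smul, ← map_mul] at h3
  rw [Finset.sum_congr rfl fun k _ => key k _ _ _ rfl, ← Finset.smul_sum] at h1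
  have h2 := smul_right_injective _ hcard h1
  change _ = ∑ k, ψ k at h2
  rw [FixPts.sum_fiber hLK g hg φ ψ] at h2
  · exact smul_right_injective _ hL0 h2
  · intro k hk
    rw [hφ]
    exact dif_pos _
  · intro k hk
    rw [FinGSet.fixed_mk_iff] at hk
    exact dif_neg hk

variable (M : MackeyFunctor.{u, max u w} G) (H : Subgroup G)

theorem FixPts.le_conj_out {G : Type u} [Group G] {H K : Subgroup G}
    (σ : FixPts H K) : H ≤ MulAut.conj σ.1.out • K := by
  rw [← FinGSet.fixed_mk_iff, QuotientGroup.out_eq']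
  exact σ.2

/-- The map `M(G/K) → F_H(M(G/H))(G/K)`, `m ↦ (R C_g m)_{gK}`. -/
noncomputable def unitApp (K : Subgroup G) : M.obj K →ₗ[ℚ] (free (Rep.of (M.weylRep H))).obj K where
  toFun m := ⟨fun σ => M.resConj σ.1.out (FixPts.le_conj_out σ) m, fun n σ => by
    have h : H ≤ MulAut.conj ((n : G) * σ.1.out) • K := by
      rw [← FinGSet.fixed_mk_iff]
      intro a ha
      have h1 := (FixPts.lmul n σ).2 a ha
      change a • (n : G) • σ.1 = (n : G) • σ.1 at h1
      rw [← QuotientGroup.out_eq' σ.1] at h1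
      exact h1
    refine Eq.trans ?_ (M.conj_resConj (n : G) σ.1.out (conj_eq_of_mem_normalizer n.2)
      (FixPts.le_conj_out σ) h m).symm
    refine M.resConj_mul _ _ ?_ m
    rw [← QuotientGroup.eq, QuotientGroup.out_eq']
    change (n : G) • σ.1 = _
    conv_lhs => rw [← QuotientGroup.out_eq' σ.1]
    rfl⟩
  map_add' a b := by
    apply Subtype.ext
    funext σ
    exact map_add _ a b
  map_smul' c a := by
    apply Subtype.ext
    funext σ
    exact map_smul _ c a

/-- The definition uses the representative `out`; by `resConj_mul` any other gives the same
component. -/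
theorem freeEval_unitApp {K : Subgroup G} (g : G) (hg : ∀ h ∈ H, h • (g : G ⧸ K) = g)
    (m : M.obj K) : freeEval (Rep.of (M.weylRep H)) (FixPts.mk g hg) (M.unitApp H K m) =
      M.resConj g ((FinGSet.fixed_mk_iff H K g).1 hg) m := by
  refine M.resConj_mul _ _ ?_ m
  rw [← QuotientGroup.eq, QuotientGroup.out_eq']
  rfl

variable {M H}

/-- The unit `M ⟶ F_H(M(G/H))` for `M = e_H M`. -/
noncomputable def unitHom (hM : IsIdemPart H M) :
    M ⟶ (freeRep H).obj ((evalRep H).obj M) :=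
  show Hom M (free (Rep.of (M.weylRep H))) from
  { app := M.unitApp H
    app_res := by
      intro K A h m
      refine free_ext _ fun g hg => ?_
      rw [freeEval_res, freeEval_unitApp, M.resConj_res g h]
      exact (freeEval_unitApp M H g _ m).symm
    app_ind := by
      classical
      intro K A h m
      refine free_ext _ fun g hg => ?_
      -- Only compatibility with induction needs `M = e_H M`.
      rw [freeEval_ind, freeEval_unitApp]
      exact hM.resConj_ind h g hg (fun τ => freeEval _ τ (M.unitApp H K m)) m
        fun x hx => freeEval_unitApp M H x hx m
    app_conj := by
      intro g K K' e m
      refine free_ext _ fun x hx => ?_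
      have hx' := (FixPts.rmul g e (FixPts.mk x hx)).2
      rw [freeEval_conj, freeEval_unitApp,
        M.resConj_conj x g e _ ((FinGSet.fixed_mk_iff H K (x * g)).1 hx')]
      exact (freeEval_unitApp M H (x * g) hx' m).symm }

theorem unitApp_injective (hM : IsIdemPart H M) (K : Subgroup G) :
    Function.Injective (M.unitApp H K) := by
  rw [injective_iff_map_eq_zero]
  intro m hm
  refine hM.eq_zero_of_res m fun g hg => ?_
  have hg' : H ≤ MulAut.conj g⁻¹ • K := by
    rwa [← conj_inv_smul_le_iff, inv_inv]
  have h1 := freeEval_unitApp M H g⁻¹ ((FinGSet.fixed_mk_iff H K g⁻¹).2 hg') m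
  rw [hm, map_zero] at h1
  have hg1 : MulAut.conj g • H ≤ MulAut.conj (g * g⁻¹) • K := by
    rwa [mul_inv_cancel, map_one, one_smul]
  -- The restriction of `m` to `gHg⁻¹` is the conjugate by `g` of the component at `g⁻¹K`, which is
  -- zero.
  have h2 := M.conj_resConj g g⁻¹ rfl hg' hg1 m
  rw [← h1, map_zero] at h2
  rw [← M.resConj_of_mem hg hg1 (by rw [mul_inv_cancel]; exact K.one_mem) m, ← h2]

/-- An element of `F_H V (G/H)` is determined by its component at `H`. -/
theorem freeEval_mk_self (V : Rep.{v} ℚ (WeylGroup H)) (y : (free V).obj H) (g : G)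
    (hg : ∀ h ∈ H, h • (g : G ⧸ H) = g) (h1 : ∀ h ∈ H, h • ((1 : G) : G ⧸ H) = (1 : G)) :
    ∃ n : Subgroup.normalizer (H : Set G), (n : G) = g ∧
      freeEval V (FixPts.mk g hg) y = V.ρ (n : WeylGroup H) (freeEval V (FixPts.mk 1 h1) y) := by
  have h2 : H = MulAut.conj g • H :=
    Subgroup.eq_of_le_of_card_ge ((FinGSet.fixed_mk_iff H H g).1 hg) (by rw [card_conj])
  have hn : g ∈ Subgroup.normalizer (H : Set G) := by
    rw [Subgroup.mem_normalizer_iff]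
    intro h
    conv_rhs => rw [h2, mem_conj_iff]
    simp [mul_assoc]
  refine ⟨⟨g, hn⟩, rfl, ?_⟩
  rw [show FixPts.mk g hg = FixPts.lmul ⟨g, hn⟩ (FixPts.mk 1 h1) from
    (FixPts.eq_iff g (g * 1) rfl rfl).2 (by simp)]
  exact y.2 ⟨g, hn⟩ _

theorem fixed_one {G : Type u} [Group G] (H : Subgroup G) :
    ∀ h ∈ H, h • ((1 : G) : G ⧸ H) = (1 : G) := by
  rw [FinGSet.fixed_mk_iff, map_one, one_smul]

theorem free_ext_self (V : Rep.{v} ℚ (WeylGroup H)) {y z : (free V).obj H}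
    (h : freeEval V (FixPts.mk 1 (fixed_one H)) y = freeEval V (FixPts.mk 1 (fixed_one H)) z) :
    y = z := by
  refine free_ext V fun g hg => ?_
  obtain ⟨n, hn, e⟩ := freeEval_mk_self V y g hg (fixed_one H)
  obtain ⟨n', hn', e'⟩ := freeEval_mk_self V z g hg (fixed_one H)
  obtain rfl : n = n' := Subtype.ext (hn.trans hn'.symm)
  rw [e, e', h]

theorem unitApp_self_surjective : Function.Surjective (M.unitApp H H) := by
  intro y
  refine ⟨freeEval _ (FixPts.mk 1 (fixed_one H)) y, free_ext_self _ ?_⟩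
  rw [freeEval_unitApp, M.resConj_of_mem le_rfl _ (one_mem H), M.res_self]

/-- The target is generated from conjugates of `H`, and the image is closed under conjugation and
induction. It therefore suffices to know surjectivity at `H` itself. -/
theorem unitApp_surjective (hM : IsIdemPart H M) (K : Subgroup G) :
    Function.Surjective (M.unitApp H K) := by
  intro y
  change y ∈ LinearMap.range (M.unitApp H K)
  refine (isIdemPart_free (Rep.of (M.weylRep H))).mem_of_avg y _ fun g hg => ?_
  generalize (free (Rep.of (M.weylRep H))).res hg y = z
  have e : H = MulAut.conj g⁻¹ • MulAut.conj g • H := by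
    rw [smul_smul, ← map_mul, inv_mul_cancel, map_one, one_smul]
  obtain ⟨m, hm⟩ := unitApp_self_surjective ((free (Rep.of (M.weylRep H))).conj g⁻¹ e z)
  refine ⟨M.ind hg (M.conj g rfl m), ((unitHom hM).app_ind hg _).trans ?_⟩
  refine congrArg _ (((unitHom hM).app_conj g rfl m).trans ?_)
  refine (congrArg ((free (Rep.of (M.weylRep H))).conj g rfl) hm).trans ?_
  have := (free (Rep.of (M.weylRep H))).conj_mul g g⁻¹ e rfl (by simp) z
  rw [← this]
  exact MackeyFunctor.conj_self _ _ (by simp) _ z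

end Unit

end MackeyFunctor

/-! ### The equivalence between the `e_H`-part and `ℚ[W_G H]`-modules -/

namespace MackeyFunctor

variable {G : Type u} [Group G]

@[ext]
theorem hom_ext {M N : MackeyFunctor.{u, v} G} {f g : M ⟶ N}
    (h : ∀ (K : Subgroup G) (m : M.obj K), Hom.app f K m = Hom.app g K m) : f = g :=
  Hom.ext (funext fun K => LinearMap.ext (h K))

/-- A morphism of Mackey functors with bijective components is an isomorphism. -/
theorem isIso_of_bijective {M N : MackeyFunctor.{u, v} G} (f : M ⟶ N)
    (h : ∀ K, Function.Bijective (Hom.app f K)) : IsIso f := by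
  let e : ∀ K, M.obj K ≃ₗ[ℚ] N.obj K := fun K => LinearEquiv.ofBijective (Hom.app f K) (h K)
  let g : Hom N M :=
    { app := fun K => (e K).symm.toLinearMap
      app_res := fun {K A} hK m => (e K).injective <| by
        obtain ⟨m, rfl⟩ := (e A).surjective m
        rw [LinearEquiv.coe_coe, LinearEquiv.coe_coe, (e A).symm_apply_apply,
          (e K).apply_symm_apply]
        exact (Hom.app_res f hK m).symm
      app_ind := fun {K A} hK m => (e A).injective <| by
        obtain ⟨m, rfl⟩ := (e K).surjective m
        rw [LinearEquiv.coe_coe, LinearEquiv.coe_coe, (e K).symm_apply_apply,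
          (e A).apply_symm_apply]
        exact (Hom.app_ind f hK m).symm
      app_conj := fun x {K A} hK m => (e A).injective <| by
        obtain ⟨m, rfl⟩ := (e K).surjective m
        rw [LinearEquiv.coe_coe, LinearEquiv.coe_coe, (e K).symm_apply_apply,
          (e A).apply_symm_apply]
        exact (Hom.app_conj f x hK m).symm }
  exact ⟨g, hom_ext fun K m => (e K).symm_apply_apply m,
    hom_ext fun K m => (e K).apply_symm_apply m⟩

variable [Finite G] (H : Subgroup G)

/-- `F_H` on representations, as a functor to `e_H Mack(G)`. -/
noncomputable def freeIdem :
    Rep.{max u w} ℚ (WeylGroup H) ⥤ IdemMackey.{u, max u w} H :=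
  (IsIdemPart.{u, max u w} H).lift (freeRep H) isIdemPart_free

/-- The unit of the equivalence between `e_H Mack(G)` and representations of `W_G H`. -/
noncomputable def unitNatTrans :
    𝟭 (IdemMackey.{u, max u w} H) ⟶ (ObjectProperty.ι _ ⋙ evalRep H) ⋙ freeIdem.{u, w} H where
  app M := ObjectProperty.homMk (unitHom M.property)
  naturality M N f := by
    refine ObjectProperty.hom_ext _ (hom_ext fun K m => ?_)
    refine free_ext _ fun g hg => ?_
    refine (freeEval_unitApp N.obj H g hg (Hom.app f.hom K m)).trans ?_
    refine Eq.trans ?_ (congrArg (Hom.app f.hom H) (freeEval_unitApp M.obj H g hg m)).symm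
    exact (Hom.app_resConj f.hom g _ m).symm

/-- Taking the component at the base point identifies `F_H V (G/H)` with `V`. -/
theorem freeEval_one_bijective (V : Rep.{v} ℚ (WeylGroup H)) :
    Function.Bijective (freeEval V (FixPts.mk (1 : G) (fixed_one H))) := by
  refine ⟨fun y z h => free_ext_self V h, fun v => ?_⟩
  -- Representatives of fixed cosets normalize `H`; `freeEval_mk_self` is applied to the zero family
  -- only to extract this.
  have hout : ∀ σ : FixPts H H, σ.1.out ∈ Subgroup.normalizer (H : Set G) := by
    intro σ
    obtain ⟨n, hn, -⟩ := freeEval_mk_self V 0 σ.1.out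
      (by rw [QuotientGroup.out_eq']; exact σ.2) (fixed_one H)
    exact hn ▸ n.2
  -- Equivariance forces the preimage of `v`: its component at `nH` must be `n v`.
  refine ⟨⟨fun σ => V.ρ ((⟨σ.1.out, hout σ⟩ : Subgroup.normalizer (H : Set G)) : WeylGroup H) v,
    fun n σ => ?_⟩, ?_⟩
  · rw [← Module.End.mul_apply, ← map_mul]
    refine congrArg (fun x => V.ρ x v) ?_
    rw [← QuotientGroup.mk_mul, QuotientGroup.eq, Subgroup.mem_subgroupOf]
    change (FixPts.lmul n σ).1.out⁻¹ * ((n : G) * σ.1.out) ∈ H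
    rw [← QuotientGroup.eq, QuotientGroup.out_eq']
    change (n : G) • σ.1 = _
    conv_lhs => rw [← QuotientGroup.out_eq' σ.1]
    rfl
  · have h1 : ((⟨(FixPts.mk (1 : G) (fixed_one H)).1.out, hout _⟩ :
        Subgroup.normalizer (H : Set G)) : WeylGroup H) = 1 := by
      rw [QuotientGroup.eq_one_iff, Subgroup.mem_subgroupOf]
      have h2 : (1 : G)⁻¹ * (FixPts.mk (1 : G) (fixed_one H)).1.out ∈ H := by
        rw [← QuotientGroup.eq, QuotientGroup.out_eq']
        rfl
      simpa using h2
    change V.ρ _ v = v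
    rw [h1, map_one, Module.End.one_apply]

/-- The counit of the equivalence between `e_H Mack(G)` and representations of `W_G H`. -/
noncomputable def counitNatTrans :
    freeIdem.{u, w} H ⋙ (ObjectProperty.ι _ ⋙ evalRep H) ⟶ 𝟭 (Rep.{max u w} ℚ (WeylGroup H)) where
  app V := Rep.ofHom (ρ := (free V).weylRep H) (σ := V.ρ)
    { freeEval V (FixPts.mk (1 : G) (fixed_one H)) with
      isIntertwining' := by
        intro x
        induction x using QuotientGroup.induction_on with
        | H n =>
          ext y
          refine Eq.trans ?_ (y.2 n _)
          refine congrArg y.1 ?_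
          rw [FixPts.eq_iff (1 * (n : G)) ((n : G) * 1) rfl rfl]
          simp }
  naturality V V' f := rfl

instance isIso_unitNatTrans : IsIso (unitNatTrans.{u, w} H) := by
  refine @NatIso.isIso_of_isIso_app _ _ _ _ _ _ _ fun M => ?_
  rw [← ObjectProperty.isIso_hom_iff]
  exact isIso_of_bijective _ fun K =>
    ⟨unitApp_injective M.property K, unitApp_surjective M.property K⟩

instance isIso_counitNatTrans : IsIso (counitNatTrans.{u, w} H) := by
  refine @NatIso.isIso_of_isIso_app _ _ _ _ _ _ _ fun V => ?_
  refine @isIso_of_reflects_iso _ _ _ _ _ _ _ (forget _) ?_ _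
  rw [isIso_iff_bijective]
  exact freeEval_one_bijective H V

/-- `e_H Mack(G)` is equivalent to the category of representations of `W_G H`. -/
noncomputable def idemEquivalenceRep :
    IdemMackey.{u, max u w} H ≌ Rep.{max u w} ℚ (WeylGroup H) :=
  -- This constructor corrects the unit to obtain the triangle identity and keeps both functors as
  -- given, so their identification below is definitional.
  CategoryTheory.Equivalence.mk (ObjectProperty.ι _ ⋙ evalRep H) (freeIdem.{u, w} H)
    (asIso (unitNatTrans.{u, w} H)) (asIso (counitNatTrans.{u, w} H))

/-- `e_H Mack(G)` is equivalent to the category of `ℚ[W_G H]`-modules. -/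
noncomputable def idemEquivalence :
    IdemMackey.{u, max u w} H ≌ ModuleCat.{max u w} ℚ[WeylGroup H] :=
  (idemEquivalenceRep.{u, w} H).trans Rep.equivalenceModuleMonoidAlgebra

theorem isIdemPart_F (V : ModuleCat.{max u w} ℚ[WeylGroup H]) :
    IsIdemPart.{u, max u w} H ((F H).obj V) :=
  isIdemPart_free _

theorem idemEquivalence_functor : (idemEquivalence.{u, w} H).functor = U H := rfl

theorem idemEquivalence_inverse : (idemEquivalence.{u, w} H).inverse =
    (IsIdemPart.{u, max u w} H).lift (F H) (isIdemPart_F H) := rfl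

end MackeyFunctor

/-! ### Splitting Mackey functors by the idempotents -/

namespace MackeyFunctor

variable {G : Type u} [Group G]

section Sub

variable (M : MackeyFunctor.{u, v} G) (P : ∀ K : Subgroup G, Submodule ℚ (M.obj K))
  (hres : ∀ {K A : Subgroup G} (h : K ≤ A), ∀ m ∈ P A, M.res h m ∈ P K)
  (hind : ∀ {K A : Subgroup G} (h : K ≤ A), ∀ m ∈ P K, M.ind h m ∈ P A)
  (hconj : ∀ (g : G) {K A : Subgroup G} (e : A = MulAut.conj g • K), ∀ m ∈ P K,
    M.conj g e m ∈ P A)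

/-- A family of submodules closed under the structure maps is a Mackey functor. -/
def sub : MackeyFunctor.{u, v} G where
  obj K := P K
  res h := (M.res h).restrict (hres h)
  ind h := (M.ind h).restrict (hind h)
  conj g _ _ e := (M.conj g e).restrict (hconj g e)
  res_self K m := Subtype.ext (M.res_self K m.1)
  ind_self K m := Subtype.ext (M.ind_self K m.1)
  conj_self h hh e m := Subtype.ext (M.conj_self h hh e m.1)
  res_trans h h' m := Subtype.ext (M.res_trans h h' m.1)
  ind_trans h h' m := Subtype.ext (M.ind_trans h h' m.1)
  conj_mul g h _ _ _ e e' e'' m := Subtype.ext (M.conj_mul g h e e' e'' m.1)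
  res_conj g _ _ _ _ h h' e e' m := Subtype.ext (M.res_conj g h h' e e' m.1)
  ind_conj g _ _ _ _ h h' e e' m := Subtype.ext (M.ind_conj g h h' e e' m.1)
  mackey hK hL s hs m := Subtype.ext <| by
    rw [AddSubmonoidClass.coe_finsetSum]
    exact M.mackey hK hL s hs m.1

end Sub

section Pi

variable {ι : Type u} (M : ι → MackeyFunctor.{u, max u w} G)

/-- The product of a family of Mackey functors. -/
def pi : MackeyFunctor.{u, max u w} G where
  obj K := ∀ i, (M i).obj K
  res h := LinearMap.pi fun i => (M i).res h ∘ₗ LinearMap.proj i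
  ind h := LinearMap.pi fun i => (M i).ind h ∘ₗ LinearMap.proj i
  conj g _ _ e := LinearMap.pi fun i => (M i).conj g e ∘ₗ LinearMap.proj i
  res_self K m := funext fun i => (M i).res_self K (m i)
  ind_self K m := funext fun i => (M i).ind_self K (m i)
  conj_self h hh e m := funext fun i => (M i).conj_self h hh e (m i)
  res_trans h h' m := funext fun i => (M i).res_trans h h' (m i)
  ind_trans h h' m := funext fun i => (M i).ind_trans h h' (m i)
  conj_mul g h _ _ _ e e' e'' m := funext fun i => (M i).conj_mul g h e e' e'' (m i)
  res_conj g _ _ _ _ h h' e e' m := funext fun i => (M i).res_conj g h h' e e' (m i)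
  ind_conj g _ _ _ _ h h' e e' m := funext fun i => (M i).ind_conj g h h' e e' (m i)
  mackey hK hL s hs m := funext fun i => by
    rw [Finset.sum_apply]
    exact (M i).mackey hK hL s hs (m i)

/-- The projections of a product of Mackey functors. -/
def piProj (i : ι) : Hom (pi M) (M i) where
  app _ := LinearMap.proj i
  app_res _ _ := rfl
  app_ind _ _ := rfl
  app_conj _ _ _ _ _ := rfl

open Classical in
/-- The inclusions into a product of Mackey functors. -/
noncomputable def piSingle (i : ι) : Hom (M i) (pi M) where
  app K := LinearMap.single ℚ (fun i => (M i).obj K) i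
  app_res h m := funext fun j =>
    (Pi.apply_single (fun j => (M j).res h) (fun _ => map_zero _) i m j).symm
  app_ind h m := funext fun j =>
    (Pi.apply_single (fun j => (M j).ind h) (fun _ => map_zero _) i m j).symm
  app_conj g _ _ e m := funext fun j =>
    (Pi.apply_single (fun j => (M j).conj g e) (fun _ => map_zero _) i m j).symm

theorem piSingle_same (i : ι) (K : Subgroup G) (m : (M i).obj K) :
    (piSingle M i).app K m i = m := by
  classical
  exact Pi.single_eq_same (M := fun i => (M i).obj K) i m

theorem piSingle_of_ne {i j : ι} (h : j ≠ i) (K : Subgroup G) (m : (M i).obj K) :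
    (piSingle M i).app K m j = 0 := by
  classical
  exact Pi.single_eq_of_ne (M := fun i => (M i).obj K) h m

theorem pi_gact [Finite G] (K : Subgroup G) (a : BurnsideRing G) (m : (pi M).obj K) (i : ι) :
    (pi M).gact K a m i = (M i).gact K a (m i) :=
  (piProj M i).app_gact K a m

end Pi

section Decomposition

variable [Finite G]

/-- The part `e_H M` of a Mackey functor `M`. -/
noncomputable def idemPart (M : MackeyFunctor.{u, v} G) (H : Subgroup G) :
    MackeyFunctor.{u, v} G :=
  M.sub (fun K => LinearMap.range (M.gact K (BurnsideRing.idem H)))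
    (by rintro K A h _ ⟨m, rfl⟩; exact ⟨_, (M.res_gact h _ m).symm⟩)
    (by rintro K A h _ ⟨m, rfl⟩; exact ⟨_, (M.ind_gact h _ m).symm⟩)
    (by rintro g K A h _ ⟨m, rfl⟩; exact ⟨_, (M.conj_gact g h _ m).symm⟩)

/-- The inclusion of `e_H M` into `M`. -/
noncomputable def idemPartι (M : MackeyFunctor.{u, v} G) (H : Subgroup G) : Hom (M.idemPart H) M where
  app K := (LinearMap.range (M.gact K (BurnsideRing.idem H))).subtype
  app_res _ _ := rfl
  app_ind _ _ := rfl
  app_conj _ _ _ _ _ := rfl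

theorem isIdemPart_idemPart (M : MackeyFunctor.{u, v} G) (H : Subgroup G) :
    IsIdemPart H (M.idemPart H) := by
  rw [isIdemPart_iff]
  rintro K ⟨_, m, rfl⟩
  apply Subtype.ext
  refine (Hom.app_gact (M.idemPartι H) K (BurnsideRing.idem H) ⟨_, m, rfl⟩).trans ?_
  change M.gact K _ (M.gact K _ m) = M.gact K _ m
  rw [← gact_mul, BurnsideRing.idem_mul_self]

/-- The projection of a Mackey functor onto `e_H M`. -/
noncomputable def toIdemPart (M : MackeyFunctor.{u, v} G) (H : Subgroup G) :
    Hom M (M.idemPart H) where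
  app K := (M.gact K (BurnsideRing.idem H)).rangeRestrict
  app_res h m := Subtype.ext (M.res_gact h _ m).symm
  app_ind h m := Subtype.ext (M.ind_gact h _ m).symm
  app_conj g _ _ e m := Subtype.ext (M.conj_gact g e _ m).symm

variable (rep : ConjSub G → Subgroup G)

/-- The product functor `∏ e_H Mack(G) ⥤ Mack(G)`. -/
noncomputable def piFunctor :
    (∀ c, IdemMackey.{u, max u w} (rep c)) ⥤ MackeyFunctor.{u, max u w} G where
  obj M := pi.{u, w} fun c => (M c).obj
  map {M N} f :=
    show Hom (pi.{u, w} fun c => (M c).obj) (pi.{u, w} fun c => (N c).obj) from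
    { app := fun K => LinearMap.pi fun c => (f c).hom.app K ∘ₗ LinearMap.proj c
      app_res := fun h m => funext fun c => (f c).hom.app_res h (m c)
      app_ind := fun h m => funext fun c => (f c).hom.app_ind h (m c)
      app_conj := fun g _ _ e m => funext fun c => (f c).hom.app_conj g e (m c) }

/-- Each component of a morphism is recovered by evaluating on families supported at one index. -/
instance : (piFunctor.{u, w} rep).Faithful where
  map_injective {M N f f'} h := by
    funext c
    refine ObjectProperty.hom_ext _ (hom_ext fun K m => ?_)
    have h1 := congrFun (congrArg (fun k => Hom.app k K
      ((piSingle.{u, w} (fun c => (M c).obj) c).app K m)) h) c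
    change (f c).hom.app K ((piSingle.{u, w} (fun c => (M c).obj) c).app K m c) =
      (f' c).hom.app K ((piSingle.{u, w} (fun c => (M c).obj) c).app K m c) at h1
    rwa [piSingle_same] at h1

variable {rep}

/-- On the factor at `d` the idempotent of `c` acts by its mark at `d`, which is 1 or 0. The
projection to a factor is thus given by the Burnside ring and commutes with all morphisms. -/
theorem pi_gact_idem (hrep : ∀ c, ConjSub.mk (rep c) = c)
    (M : ∀ c, IdemMackey.{u, max u w} (rep c)) (K : Subgroup G) (c : ConjSub G)
    (m : (pi.{u, w} fun c => (M c).obj).obj K) :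
    (pi.{u, w} fun c => (M c).obj).gact K (BurnsideRing.idem (rep c)) m =
      (piSingle.{u, w} (fun c => (M c).obj) c).app K (m c) := by
  classical
  funext d
  rw [pi_gact, (M d).property.gact_eq_smul, BurnsideRing.marks_idem, hrep, hrep]
  by_cases h : d = c
  · subst h
    rw [Pi.single_eq_same, one_smul, piSingle_same]
  · rw [Pi.single_eq_of_ne h, zero_smul, piSingle_of_ne _ h]

/-- A morphism of products commutes with the idempotents, hence is diagonal and equals the product
of its diagonal components. -/
theorem piFunctor_full (hrep : ∀ c, ConjSub.mk (rep c) = c) :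
    (piFunctor.{u, w} rep).Full where
  map_surjective {M N} f := by
    refine ⟨fun c => ObjectProperty.homMk
      (X := M c) (Y := N c) (show (M c).obj ⟶ (N c).obj from
        piSingle.{u, w} (fun c => (M c).obj) c ≫ f ≫ piProj.{u, w} (fun c => (N c).obj) c),
      hom_ext fun K m => funext fun c => ?_⟩
    change Hom.app f K ((piSingle.{u, w} (fun c => (M c).obj) c).app K (m c)) c = Hom.app f K m c
    refine (congrFun (congrArg (Hom.app f K) (pi_gact_idem hrep M K c m).symm) c).trans ?_
    refine (congrFun (Hom.app_gact f K _ m) c).trans ?_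
    refine (congrFun (pi_gact_idem hrep N K c _) c).trans ?_
    exact piSingle_same _ c K _

/-- Injectivity uses that the idempotents sum to 1, surjectivity that they are orthogonal. -/
theorem bijective_toIdemPart (hrep : ∀ c, ConjSub.mk (rep c) = c)
    (M : MackeyFunctor.{u, v} G) (K : Subgroup G) :
    Function.Bijective fun (m : M.obj K) (c : ConjSub G) => (M.toIdemPart (rep c)).app K m := by
  have := Fintype.ofFinite (ConjSub G)
  have hsum : ∀ m : M.obj K, ∑ c, M.gact K (BurnsideRing.idem (rep c)) m = m := fun m => by
    rw [← LinearMap.sum_apply, ← map_sum, BurnsideRing.sum_idem rep hrep, gact_one]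
  constructor
  · intro m m' h
    rw [← hsum m, ← hsum m']
    exact Finset.sum_congr rfl fun c _ => congrArg Subtype.val (congrFun h c)
  · intro y
    choose z hz using fun c => (y c).2
    refine ⟨∑ d, M.gact K (BurnsideRing.idem (rep d)) (z d), funext fun c => Subtype.ext ?_⟩
    change M.gact K _ _ = (y c).1
    rw [map_sum, Finset.sum_eq_single c, ← gact_mul, BurnsideRing.idem_mul_self, hz]
    · intro d _ hd
      rw [← gact_mul, BurnsideRing.idem_mul_of_ne, map_zero, LinearMap.zero_apply]
      rw [hrep, hrep]
      exact hd.symm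
    · exact fun h => (h (Finset.mem_univ _)).elim

theorem piFunctor_essSurj (hrep : ∀ c, ConjSub.mk (rep c) = c) :
    (piFunctor.{u, w} rep).EssSurj where
  mem_essImage M := by
    let f : M ⟶ pi.{u, w} fun c => M.idemPart (rep c) :=
      show Hom M (pi.{u, w} fun c => M.idemPart (rep c)) from
      { app := fun K => LinearMap.pi fun c => (M.toIdemPart (rep c)).app K
        app_res := fun h m => funext fun c => (M.toIdemPart (rep c)).app_res h m
        app_ind := fun h m => funext fun c => (M.toIdemPart (rep c)).app_ind h m
        app_conj := fun g _ _ e m => funext fun c => (M.toIdemPart (rep c)).app_conj g e m }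
    have : IsIso f := isIso_of_bijective f fun K => bijective_toIdemPart hrep M K
    exact ⟨fun c => ⟨M.idemPart (rep c), isIdemPart_idemPart M (rep c)⟩, ⟨(asIso f).symm⟩⟩

/-- The splitting of the category of rational Mackey functors by the idempotents of the Burnside
ring. -/
noncomputable def piEquivalence (hrep : ∀ c, ConjSub.mk (rep c) = c) :
    (∀ c, IdemMackey.{u, max u w} (rep c)) ≌ MackeyFunctor.{u, max u w} G :=
  have : (piFunctor.{u, w} rep).IsEquivalence :=
    { full := piFunctor_full hrep
      essSurj := piFunctor_essSurj hrep }
  (piFunctor.{u, w} rep).asEquivalence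

end Decomposition

end MackeyFunctor

end RatMackey

open RatMackey RatMackey.MackeyFunctor in
theorem mainTheorem1 (G : Type u) [Group G] [Finite G] :
    (∀ H : Subgroup G,
      ∃ hF : ∀ V : ModuleCat.{max u w} ℚ[WeylGroup H], IsIdemPart.{u, max u w} H ((F H).obj V),
      ∃ E : IdemMackey.{u, max u w} H ≌ ModuleCat.{max u w} ℚ[WeylGroup H],
        E.functor = U H ∧ E.inverse = (IsIdemPart.{u, max u w} H).lift (F H) hF) ∧
    ∀ rep : ConjSub G → Subgroup G, (∀ c, ConjSub.mk (rep c) = c) →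
      Nonempty (MackeyFunctor.{u, max u w} G ≌
        ∀ c : ConjSub G, ModuleCat.{max u w} ℚ[WeylGroup (rep c)]) :=
  ⟨fun H => ⟨isIdemPart_F H, idemEquivalence.{u, w} H, idemEquivalence_functor H,
    -- The second statement follows by applying the first in each factor of the splitting.
    idemEquivalence_inverse H⟩, fun rep hrep => ⟨(piEquivalence.{u, w} hrep).symm.trans
      (Equivalence.pi fun c => idemEquivalence.{u, w} (rep c))⟩⟩
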